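/- **Setting.** Let $S_j(x)=\rho_jx+b_j$ $(1\le j\le m)$ be maps of $\mathbb R$ with $0<|\rho_j|<1$, and let $K$ be their attractor, i.e. the unique non-empty compact set with $K=\bigcup_jS_j(K)$. Assume $S_j((0,1))\subset(0,1)$ for all $j$. For a finite word $\mathbf i=(i_1,\dots,i_k)$ over $\{1,\dots,m\}$ put $S_{\mathbf i}=S_{i_1}\circ\cdots\circ S_{i_k}$ (the identity for the empty word) and $|\mathbf i|=k$; write $\mathbf i\preceq\mathbf j$ if $\mathbf i$ is an initial segment of $\mathbf j$. For a set $E\subset\mathbb R$, $|E|$ denotes its diameter. A *sequence of nested index sets* is a sequence $(\mathcal M_k)_{k\ge0}$ of non-empty finite sets of words, with $\mathcal M_0$ consisting of the empty word only, such that: (1) $\min_{\mathbf i\in\mathcal M_k}|\mathbf i|$ and $\max_{\mathbf i\in\mathcal M_k}|\mathbf i|$ are non-decreasing in $k$ and tend to infinity; (2) distinct elements of $\mathcal M_k$ are incomparable for $\preceq$; (3) every word longer than $\max_{\mathbf i\in\mathcal M_k}|\mathbf i|$ has an initial segment in $\mathcal M_k$; (4) every word shorter than $\min_{\mathbf i\in\mathcal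 M_k}|\mathbf i|$ is an initial segment of an element of $\mathcal M_k$; (5) there is $L\ge1$, independent of $k$, such that $|\mathbf j|-|\mathbf i|\le L$ whenever $\mathbf i\in\mathcal M_k$, $\mathbf j\in\mathcal M_{k+1}$, $\mathbf i\preceq\mathbf j$. Given such a sequence, the *$k$-th generation islands* are the closures of the connected components of $\bigcup_{\mathbf i\in\mathcal M_k}S_{\mathbf i}((0,1))$; their set is $\mathcal F_k^0$. For $I\in\mathcal F^0_k$ let $\mathcal V(I)=\{S_{\mathbf i}:\mathbf i\in\mathcal M_k,\ S_{\mathbf i}([0,1])\subset I\}$. Islands are considered together with their generation. Islands $I\in\mathcal F^0_k$ and $I'\in\mathcal F^0_{k'}$ are *equivalent* if there is a map $\tau(x)=ax+c$, $a\ne0$, with $\tau(I)=I'$, $\mathcal V(I')=\{\tau\circ f: f\in\mathcal V(I)\}$, and, for all $l\ge1$ and $J\subset I$, $J\in\mathcal F^0_{k+l}$ if and only if $\tau(J)\in\mathcal F^0_{k'+l}$. The equivalence classes $[I]$ are the *overlap types*. The system satisfies the *generalized finite type condition* with respect to $(0,1)$ if, for some sequence of nested index sets, there are only finitely many overlap types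 $\mathcal T_1,\dots,\mathcal T_q$. For such a sequence and $\alpha\ge 0$ the *weighted incidence matrix* $A_\alpha$ is the $q\times q$ matrix $$A_\alpha(i,j)=\sum\Big\{\Big(\frac{|J|}{|I|}\Big)^\alpha:\ J\in\mathcal F^0_{k+1},\ J\subset I,\ [J]=\mathcal T_j\Big\},$$ where $I\in\mathcal F^0_k$ is any chosen island with $[I]=\mathcal T_i$. **Corollary 1.3.** Suppose that the system satisfies the generalized finite type condition with respect to $(0,1)$ and that $A_\alpha$ is irreducible, where $\alpha=\dim_HK$ is the Hausdorff dimension of $K$. Let $\mathcal H^\alpha$ be the $\alpha$-dimensional Hausdorff measure. Then $0<\mathcal H^\alpha(K)<\infty$, and with $\lambda=\mathcal H^\alpha|_K/\mathcal H^\alpha(K)$, $$\mathcal H^\alpha(K)^{-1}=\sup\Big\{\frac{\lambda(J)}{|J|^\alpha}:\ J\subset[0,1]\text{ an interval},\ |J|>0\Big\}.$$ -/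

import Mathlib

open Set MeasureTheory Filter
open scoped ENNReal NNReal

namespace LinearCantor

noncomputable section

/-- A linear iterated function system `S_j(x) = ρ_j x + b_j`, `j = 1, …, m`, of contractive
similitudes of the real line.  Negative ratios are allowed. -/
structure LinearIFS (m : ℕ) where
  ρ : Fin m → ℝ
  b : Fin m → ℝ
  ratio_pos : ∀ j, 0 < |ρ j|
  ratio_lt_one : ∀ j, |ρ j| < 1

/-- Finite words over the alphabet of the system. -/
abbrev Word (m : ℕ) : Type := List (Fin m)

namespace LinearIFS

variable {m : ℕ} (S : LinearIFS m)

/-- The similitude `S_j`. -/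
def map (j : Fin m) (x : ℝ) : ℝ := S.ρ j * x + S.b j

/-- `S_𝐢 = S_{i₁} ∘ ⋯ ∘ S_{i_k}`, with the identity for the empty word. -/
def wordMap : Word m → ℝ → ℝ
  | [] => id
  | j :: w => S.map j ∘ wordMap w

/-- `K` is the attractor: the (unique) non-empty compact set with `K = ⋃ j, S_j(K)`. -/
structure IsAttractor (K : Set ℝ) : Prop where
  nonempty : K.Nonempty
  isCompact : IsCompact K
  eq_iUnion : K = ⋃ j, S.map j '' K

/-- The open interval `(0,1)` is invariant under the system. -/
def UnitIntervalInvariant : Prop := ∀ j, S.map j '' Ioo 0 1 ⊆ Ioo 0 1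

end LinearIFS

/-- The least length of a word in a (non-empty) finite set of words. -/
def minLength {m : ℕ} (F : Finset (Word m)) : ℕ := sInf (List.length '' (F : Set (Word m)))

/-- The greatest length of a word in a finite set of words. -/
def maxLength {m : ℕ} (F : Finset (Word m)) : ℕ := F.sup List.length

/-- Sequences `M_0, M_1, …` of nested index sets (`u <+: w` says that `u` is an initial segment
of `w`). -/
structure IsNestedIndexSequence {m : ℕ} (M : ℕ → Finset (Word m)) : Prop where
  nonempty : ∀ k, (M k).Nonempty
  zero : M 0 = {[]}
  minLength_mono : Monotone fun k => minLength (M k)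
  minLength_tendsto : Tendsto (fun k => minLength (M k)) atTop atTop
  maxLength_mono : Monotone fun k => maxLength (M k)
  maxLength_tendsto : Tendsto (fun k => maxLength (M k)) atTop atTop
  incomparable : ∀ k, ∀ i ∈ M k, ∀ j ∈ M k, i ≠ j → ¬ i <+: j ∧ ¬ j <+: i
  exists_prefix : ∀ k, ∀ j : Word m, maxLength (M k) < j.length → ∃ i ∈ M k, i <+: j
  exists_extension : ∀ k, ∀ j : Word m, j.length < minLength (M k) → ∃ i ∈ M k, j <+: i
  bounded_step : ∃ L : ℕ, 0 < L ∧
    ∀ k, ∀ i ∈ M k, ∀ j ∈ M (k + 1), i <+: j → j.length - i.length ≤ L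

namespace LinearIFS

variable {m : ℕ} (S : LinearIFS m) (M : ℕ → Finset (Word m))

/-- `⋃ S_𝐢((0,1))` over `𝐢 ∈ M_k`. -/
def levelOpen (k : ℕ) : Set ℝ := ⋃ i ∈ M k, S.wordMap i '' Ioo 0 1

/-- The `k`-th generation islands: the closures of the connected components of `levelOpen k`. -/
def islands (k : ℕ) : Set (Set ℝ) :=
  {I | ∃ x ∈ S.levelOpen M k, I = closure (connectedComponentIn (S.levelOpen M k) x)}

/-- The maps `S_𝐯` of the `k`-th generation vertices `𝐯` whose interval `S_𝐯([0,1])` is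
contained in `I`, that is `{S_𝐯 : 𝐯 ∈ V(I)}`. -/
def islandMaps (k : ℕ) (I : Set ℝ) : Set (ℝ → ℝ) :=
  {f | ∃ i ∈ M k, S.wordMap i = f ∧ f '' Icc 0 1 ⊆ I}

/-- Islands of all generations.  An island remembers its generation: the same set of reals may
be an island in several generations. -/
structure Island where
  gen : ℕ
  carrier : Set ℝ
  mem : carrier ∈ S.islands M gen

variable {S M}

/-- Two islands are equivalent when a linear function `τ(x) = a x + c` maps one onto the other,
carries the maps of the vertices of the first to those of the second, and identifies the later
generation islands contained in them. -/
def Island.Equivalent (I I' : S.Island M) : Prop :=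
  ∃ a c : ℝ, a ≠ 0 ∧ (fun x => a * x + c) '' I.carrier = I'.carrier ∧
    S.islandMaps M I'.gen I'.carrier =
      (fun f => (fun x => a * x + c) ∘ f) '' S.islandMaps M I.gen I.carrier ∧
    ∀ l : ℕ, 1 ≤ l → ∀ J ⊆ I.carrier,
      J ∈ S.islands M (I.gen + l) ↔ (fun x => a * x + c) '' J ∈ S.islands M (I'.gen + l)

theorem Island.equivalent_refl (I : S.Island M) : I.Equivalent I :=
  ⟨1, 0, one_ne_zero, by simp, by simp [Function.comp_def], by simp⟩

theorem Island.Equivalent.symm {I I' : S.Island M} (h : I.Equivalent I') :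
    I'.Equivalent I := by
  obtain ⟨a, c, ha, h1, h2, h3⟩ := h
  have e1 : ∀ x, a⁻¹ * (a * x + c) + -(a⁻¹ * c) = x := fun x => by field_simp; ring
  have e2 : ∀ x, a * (a⁻¹ * x + -(a⁻¹ * c)) + c = x := fun x => by field_simp; ring
  refine ⟨a⁻¹, -(a⁻¹ * c), inv_ne_zero ha, ?_, ?_, ?_⟩
  · rw [← h1, image_image]; simp [e1]
  · rw [h2, image_image]; simp [Function.comp_def, e1]
  · intro l hl J hJ
    have hsub : (fun x => a⁻¹ * x + -(a⁻¹ * c)) '' J ⊆ I.carrier := by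
      rintro _ ⟨y, hy, rfl⟩
      obtain ⟨x, hx, rfl⟩ := h1.symm ▸ hJ hy
      simpa [e1] using hx
    rw [h3 l hl _ hsub, image_image]
    simp [e2]

theorem Island.Equivalent.trans {I I' I'' : S.Island M} (h : I.Equivalent I')
    (h' : I'.Equivalent I'') : I.Equivalent I'' := by
  obtain ⟨a, c, ha, h1, h2, h3⟩ := h
  obtain ⟨a', c', ha', h1', h2', h3'⟩ := h'
  have e : ∀ x, a' * (a * x + c) + c' = a' * a * x + (a' * c + c') := fun x => by ring
  refine ⟨a' * a, a' * c + c', mul_ne_zero ha' ha, ?_, ?_, ?_⟩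
  · rw [← h1', ← h1, image_image]; simp [e]
  · rw [h2', h2, image_image]; simp [Function.comp_def, e]
  · intro l hl J hJ
    rw [h3 l hl J hJ, h3' l hl _ (h1 ▸ image_mono hJ), image_image]
    simp [e]

variable (S M)

/-- The equivalence relation on islands. -/
def islandSetoid : Setoid (S.Island M) where
  r := Island.Equivalent
  iseqv := ⟨Island.equivalent_refl, Island.Equivalent.symm, Island.Equivalent.trans⟩

/-- Overlap types: equivalence classes of islands. -/
def OverlapType : Type := Quotient (S.islandSetoid M)

variable {S M}

/-- The overlap type `[I]` of an island. -/
def Island.overlapType (I : S.Island M) : S.OverlapType M := Quotient.mk (S.islandSetoid M) I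

/-- The offsprings of an island: the next generation islands contained in it. -/
def Island.offspring (I : S.Island M) : Set (S.Island M) :=
  {J | J.gen = I.gen + 1 ∧ J.carrier ⊆ I.carrier}

variable (S M)

theorem continuous_wordMap (w : Word m) : Continuous (S.wordMap w) := by
  induction w with
  | nil => exact continuous_id
  | cons j w ih =>
    have : Continuous (S.map j) := by unfold LinearIFS.map; fun_prop
    exact this.comp ih

/-- Each generation has finitely many islands. -/
theorem finite_islands (k : ℕ) : (S.islands M k).Finite := by
  refine ((M k).finite_toSet.image fun i =>
    closure (connectedComponentIn (S.levelOpen M k) (S.wordMap i (1 / 2)))).subset ?_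
  rintro I ⟨x, hx, rfl⟩
  obtain ⟨i, hi, hxi⟩ := mem_iUnion₂.1 hx
  refine ⟨i, hi, ?_⟩
  have hpre : IsPreconnected (S.wordMap i '' Ioo 0 1) :=
    isPreconnected_Ioo.image _ (S.continuous_wordMap i).continuousOn
  have hsub : S.wordMap i '' Ioo 0 1 ⊆ S.levelOpen M k :=
    subset_iUnion₂ (s := fun i (_ : i ∈ M k) => S.wordMap i '' Ioo (0 : ℝ) 1) i hi
  have hmem : S.wordMap i (1 / 2) ∈ S.wordMap i '' Ioo 0 1 :=
    mem_image_of_mem _ ⟨by norm_num, by norm_num⟩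
  have := hpre.subset_connectedComponentIn hxi hsub hmem
  simp only [connectedComponentIn_eq this]

variable {S M}

/-- An island has finitely many offsprings, so the sums in `weightedIncidence` are honest. -/
theorem Island.finite_offspring (I : S.Island M) : I.offspring.Finite := by
  refine Finite.of_finite_image (f := Island.carrier)
    ((S.finite_islands M (I.gen + 1)).subset ?_) ?_
  · rintro _ ⟨J, hJ, rfl⟩
    exact hJ.1 ▸ J.mem
  · rintro ⟨g, c, h⟩ hJ ⟨g', c', h'⟩ hJ' hc
    obtain rfl : g = g' := hJ.1.trans hJ'.1.symm
    obtain rfl : c = c' := hc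
    rfl

/-- The weighted incidence matrix `A_α`, indexed by the overlap types.  Its `(T, T')` entry is the
sum of `(|J| / |I|) ^ α` over the offsprings `J` of type `T'` of a chosen island `I = rep T` of
type `T`. -/
def weightedIncidence (rep : S.OverlapType M → S.Island M) (α : ℝ) :
    Matrix (S.OverlapType M) (S.OverlapType M) ℝ := fun T T' =>
  ∑ᶠ J ∈ {J : S.Island M | J ∈ (rep T).offspring ∧ J.overlapType = T'},
    (Metric.diam J.carrier / Metric.diam (rep T).carrier) ^ α

variable (S M)

/-- The system satisfies the generalized finite type condition with respect to the invariant open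
set `(0,1)`, and the sequence of nested index sets `M` witnesses it. -/
structure IsGeneralizedFiniteType : Prop where
  invariant : S.UnitIntervalInvariant
  nested : IsNestedIndexSequence M
  finite_types : Finite (S.OverlapType M)

end LinearIFS

/-- The normalized measure `λ = H^α|_K / H^α(K)`. -/
def normalizedHausdorff (α : ℝ) (K : Set ℝ) : Measure ℝ :=
  (μH[α] K)⁻¹ • (μH[α] : Measure ℝ).restrict K

end

end LinearCantor

/-! Suppose first that α > 0. The formula rests on the fact that, on K, Hausdorff measure in the
critical dimension agrees with Hausdorff content.

Disjoint copies `S_w(K)` have total weight `∑ r_w ^ α ≤ 1` (`sum_ratio_rpow_le_one`). Otherwise the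
sum still exceeds 1 for some s > α. Pulling covers back into the copies then bounds the s-weight of
every finite cover of K from below, so `H^s(K) > 0`, against `dim K < s`. With this bound, Vitali's
theorem covers K by finitely many disjoint tiny copies of K and balls of negligible weight. Planting
an arbitrary cover of K in each copy gives covers of arbitrarily fine mesh and almost no greater
weight, so `H^α(K)` is at most the weight of any cover (`hausdorffMeasure_le_tsum`). Hence `H^α(K) <
∞`. Covering K by J and a near-optimal cover of `K \ J` gives `H^α(K ∩ J) ≤ |J| ^ α`, the upper
bound for the density. Conversely, if `λ(J) ≤ D |J| ^ α` with `D < H^α(K)⁻¹`, a cover of K of weight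
below `D⁻¹`, made of intervals by convex hulls, would give `λ(K) < 1`.

Positivity comes from the finite type condition. Finitely many overlap types leave finitely many
relative positions `S_v⁻¹ S_w` for overlapping copies of comparable size (`finite_neighborMaps`), so
the part of K in a set of diameter at most r lies in N copies of ratio at most r
(`exists_card_le_cover`). If `H^α(K) = 0`, a cover of very small weight becomes a finite cover of K
by its own copies with α-weight below 1, hence with β-weight below 1 for some β < α. Iteration gives
`H^β(K) = 0`, against `dim K > β`.

If α = 0, two disjoint copies would already have weight 2, so K is a point. -/

namespace LinearCantor

open Topology

/-! ### Hausdorff measure and covers -/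

/-- A set of Hausdorff measure less than `c` has a countable cover by sets of diameter at most `1`
witnessing this. -/
theorem exists_cover_of_hausdorffMeasure_lt {X : Type*} [EMetricSpace X] [MeasurableSpace X]
    [BorelSpace X] {α : ℝ} (hα : 0 < α) {A : Set X} {c : ℝ≥0∞} (h : μH[α] A < c) :
    ∃ U : ℕ → Set X, A ⊆ ⋃ n, U n ∧ (∀ n, Metric.ediam (U n) ≤ 1) ∧
      ∑' n, Metric.ediam (U n) ^ α < c := by
  rw [Measure.hausdorffMeasure_apply] at h
  have h1 := (le_iSup₂ (f := fun (r : ℝ≥0∞) (_ : 0 < r) => ⨅ (t : ℕ → Set X) (_ : A ⊆ ⋃ n, t n)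
    (_ : ∀ n, Metric.ediam (t n) ≤ r), ∑' n, ⨆ (_ : (t n).Nonempty), Metric.ediam (t n) ^ α)
    1 one_pos).trans_lt h
  simp only [iInf_lt_iff] at h1
  obtain ⟨t, ht, hr, hs⟩ := h1
  refine ⟨t, ht, hr, lt_of_le_of_lt (ENNReal.tsum_le_tsum fun n => ?_) hs⟩
  rcases (t n).eq_empty_or_nonempty with h | h
  · simp [h, hα]
  · exact le_iSup (fun _ : (t n).Nonempty => Metric.ediam (t n) ^ α) h

/-- A compact set of Hausdorff measure zero has finite covers of arbitrarily small weight. -/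
theorem exists_finite_cover_of_hausdorffMeasure_eq_zero {X : Type*} [MetricSpace X]
    [MeasurableSpace X] [BorelSpace X] {α : ℝ} (hα : 0 < α) {K : Set X} (hK : IsCompact K)
    (h : μH[α] K = 0) {ε : ℝ≥0∞} (hε : ε ≠ 0) :
    ∃ (T : Finset ℕ) (U : ℕ → Set X) (r : ℕ → ℝ≥0), K ⊆ ⋃ n ∈ T, U n ∧ (∀ n, 0 < r n) ∧
      (∀ n, Metric.ediam (U n) ≤ r n) ∧ ∑ n ∈ T, (r n : ℝ≥0∞) ^ α < ε := by
  have hε2 : ε / 2 ≠ 0 := by simpa using hε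
  obtain ⟨t, htK, ht1, hts⟩ := exists_cover_of_hausdorffMeasure_lt (A := K) hα
    (c := ε / 2) (by rw [h]; exact pos_iff_ne_zero.2 hε2)
  obtain ⟨e, he0, hes⟩ := ENNReal.exists_pos_sum_of_countable hε2 ℕ
  have hfin : ∀ n, Metric.ediam (t n) ≠ ∞ := fun n => ((ht1 n).trans_lt ENNReal.one_lt_top).ne
  set d : ℕ → ℝ≥0 := fun n => (Metric.ediam (t n)).toNNReal with hd
  have hdc : ∀ n, (d n : ℝ≥0∞) = Metric.ediam (t n) := fun n => ENNReal.coe_toNNReal (hfin n)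
  -- The radius spends an extra `e n` of weight, leaving room above the diameter to thicken `t n` to
  -- an open set; compactness then selects finitely many.
  set r : ℕ → ℝ≥0 := fun n => (d n ^ α + e n) ^ α⁻¹ with hr
  have hdr : ∀ n, d n < r n := fun n => by
    rw [hr, NNReal.lt_rpow_inv_iff hα]
    exact lt_add_of_pos_right _ (he0 n)
  have hrα : ∀ n, (r n : ℝ≥0∞) ^ α = Metric.ediam (t n) ^ α + e n := fun n => by
    rw [← hdc, ← ENNReal.coe_rpow_of_nonneg _ hα.le, ← ENNReal.coe_rpow_of_nonneg _ hα.le, hr,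
      ← ENNReal.coe_add]
    simp only [NNReal.rpow_inv_rpow hα.ne']
  set δ : ℕ → ℝ≥0 := fun n => (r n - d n) / 2 with hδ
  have hδ0 : ∀ n, 0 < δ n := fun n => by
    have := tsub_pos_of_lt (hdr n)
    simp only [hδ]; positivity
  obtain ⟨T, hT⟩ := hK.elim_finite_subcover (fun n => Metric.thickening (δ n) (t n))
    (fun n => Metric.isOpen_thickening) (htK.trans <| iUnion_mono fun n =>
      Metric.self_subset_thickening (by exact_mod_cast hδ0 n) _)
  refine ⟨T, fun n => Metric.thickening (δ n) (t n), r, hT, fun n => (zero_le).trans_lt (hdr n),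
    fun n => ?_, ?_⟩
  · refine (Metric.ediam_thickening_le _).trans ?_
    rw [← hdc]
    have : d n + 2 * δ n = r n := by
      simp only [hδ]; rw [mul_div_cancel₀ _ two_ne_zero, add_tsub_cancel_of_le (hdr n).le]
    exact_mod_cast this.le
  · calc ∑ n ∈ T, (r n : ℝ≥0∞) ^ α ≤ ∑' n, (r n : ℝ≥0∞) ^ α := ENNReal.sum_le_tsum _
      _ = ∑' n, Metric.ediam (t n) ^ α + ∑' n, (e n : ℝ≥0∞) := by
        simp only [hrα]; rw [ENNReal.tsum_add]
      _ < ε / 2 + ε / 2 := ENNReal.add_lt_add hts hes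
      _ = ε := ENNReal.add_halves ε

/-- A finite sum of powers depends continuously on the exponent. -/
theorem tendsto_sum_rpow {ι : Type*} (F : Finset ι) (r : ι → ℝ≥0) (hr : ∀ i ∈ F, r i ≠ 0) (s : ℝ) :
    Tendsto (fun t : ℝ => ∑ i ∈ F, (r i : ℝ≥0∞) ^ t) (𝓝 s) (𝓝 (∑ i ∈ F, (r i : ℝ≥0∞) ^ s)) := by
  refine tendsto_finsetSum _ fun i hi => ?_
  have : ∀ t : ℝ, (r i : ℝ≥0∞) ^ t = ((r i ^ t : ℝ≥0) : ℝ≥0∞) := fun t =>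
    (ENNReal.coe_rpow_of_ne_zero (hr i hi) t).symm
  rw [funext this, ENNReal.tendsto_coe]
  exact ((continuousAt_const (y := r i)).nnrpow continuousAt_id (Or.inl (hr i hi)))

namespace LinearIFS

variable {m : ℕ} (S : LinearIFS m)

/-! ### The similitudes of words -/

/-- The contraction ratio `|ρ_{i₁} ⋯ ρ_{i_k}|` of a word. -/
noncomputable def ratio (w : Word m) : ℝ≥0 := (w.map fun j => ‖S.ρ j‖₊).prod

@[simp] theorem ratio_nil : S.ratio [] = 1 := rfl

@[simp] theorem ratio_cons (j : Fin m) (w : Word m) : S.ratio (j :: w) = ‖S.ρ j‖₊ * S.ratio w := by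
  simp [ratio]

@[simp] theorem ratio_append (v w : Word m) : S.ratio (v ++ w) = S.ratio v * S.ratio w := by
  simp [ratio]

theorem nnnorm_ratio_pos (j : Fin m) : 0 < ‖S.ρ j‖₊ := by
  simpa [nnnorm_pos] using S.ratio_pos j

theorem nnnorm_ratio_lt_one (j : Fin m) : ‖S.ρ j‖₊ < 1 := by
  rw [← NNReal.coe_lt_coe]; simpa using S.ratio_lt_one j

theorem ratio_word_pos (w : Word m) : 0 < S.ratio w := by
  induction w with
  | nil => simp
  | cons j w ih => rw [ratio_cons]; exact mul_pos (S.nnnorm_ratio_pos j) ih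

theorem ratio_word_le_one (w : Word m) : S.ratio w ≤ 1 := by
  induction w with
  | nil => simp
  | cons j w ih => rw [ratio_cons]; exact mul_le_one' (S.nnnorm_ratio_lt_one j).le ih

theorem exists_uniform_ratio_bounds : ∃ c θ : ℝ≥0, 0 < c ∧ c ≤ 1 ∧ θ < 1 ∧
    (∀ j, c ≤ ‖S.ρ j‖₊) ∧ ∀ j, ‖S.ρ j‖₊ ≤ θ := by
  rcases isEmpty_or_nonempty (Fin m) with h | h
  · exact ⟨1, 0, one_pos, le_rfl, one_pos, fun j => h.elim j, fun j => h.elim j⟩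
  · obtain ⟨i, hi⟩ := Finite.exists_min fun j => ‖S.ρ j‖₊
    obtain ⟨k, hk⟩ := Finite.exists_max fun j => ‖S.ρ j‖₊
    exact ⟨_, _, S.nnnorm_ratio_pos i, (S.nnnorm_ratio_lt_one i).le, S.nnnorm_ratio_lt_one k,
      hi, hk⟩

theorem ratio_le_pow {θ : ℝ≥0} (hθ : ∀ j, ‖S.ρ j‖₊ ≤ θ) (w : Word m) :
    S.ratio w ≤ θ ^ w.length := by
  induction w with
  | nil => simp
  | cons j w ih =>
    rw [ratio_cons, List.length_cons, pow_succ, mul_comm]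
    exact mul_le_mul' ih (hθ j)

theorem pow_le_ratio {c : ℝ≥0} (hc : ∀ j, c ≤ ‖S.ρ j‖₊) (w : Word m) :
    c ^ w.length ≤ S.ratio w := by
  induction w with
  | nil => simp
  | cons j w ih =>
    rw [ratio_cons, List.length_cons, pow_succ, mul_comm]
    exact mul_le_mul' (hc j) ih

/-- The similitude `S_w` as a permutation of the line. -/
noncomputable def wordPerm (w : Word m) : Equiv.Perm ℝ :=
  (w.map fun j => (⟨S.map j, fun y => (S.ρ j)⁻¹ * (y - S.b j),
    fun x => by
      have := abs_pos.1 (S.ratio_pos j)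
      simp only [LinearIFS.map]; field_simp; ring,
    fun x => by
      have := abs_pos.1 (S.ratio_pos j)
      simp only [LinearIFS.map]; field_simp; ring⟩ : Equiv.Perm ℝ)).prod

theorem coe_wordPerm (w : Word m) : ⇑(S.wordPerm w) = S.wordMap w := by
  induction w with
  | nil => rfl
  | cons j w ih =>
    simp only [wordPerm, List.map_cons, List.prod_cons, Equiv.Perm.coe_mul] at ih ⊢
    rw [ih]; rfl

theorem wordPerm_append (v w : Word m) : S.wordPerm (v ++ w) = S.wordPerm v * S.wordPerm w := by
  simp [wordPerm]

theorem wordMap_append (v w : Word m) : S.wordMap (v ++ w) = S.wordMap v ∘ S.wordMap w := by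
  simp [← coe_wordPerm, wordPerm_append]

theorem wordMap_injective (w : Word m) : Function.Injective (S.wordMap w) :=
  S.coe_wordPerm w ▸ (S.wordPerm w).injective

theorem wordMap_surjective (w : Word m) : Function.Surjective (S.wordMap w) :=
  S.coe_wordPerm w ▸ (S.wordPerm w).surjective

theorem nndist_wordMap (w : Word m) (x y : ℝ) :
    nndist (S.wordMap w x) (S.wordMap w y) = S.ratio w * nndist x y := by
  induction w with
  | nil => simp [wordMap]
  | cons j w ih =>
    rw [ratio_cons, mul_assoc, ← ih]
    simp only [wordMap, Function.comp, LinearIFS.map]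
    rw [nndist_add_right, nndist_eq_nnnorm, nndist_eq_nnnorm, ← mul_sub, nnnorm_mul]

theorem dist_wordMap (w : Word m) (x y : ℝ) :
    dist (S.wordMap w x) (S.wordMap w y) = S.ratio w * dist x y := by
  simpa using congrArg NNReal.toReal (S.nndist_wordMap w x y)

theorem lipschitzWith_wordMap (w : Word m) : LipschitzWith (S.ratio w) (S.wordMap w) :=
  LipschitzWith.of_dist_le_mul fun x y => (S.dist_wordMap w x y).le

theorem ediam_wordMap_image_le (w : Word m) (A : Set ℝ) :
    Metric.ediam (S.wordMap w '' A) ≤ S.ratio w * Metric.ediam A :=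
  (S.lipschitzWith_wordMap w).ediam_image_le A

/-- This is the direction needed to turn a cover of a copy of K into a cover of K itself with
controlled weight. -/
theorem ratio_mul_ediam_preimage_le (w : Word m) (A : Set ℝ) :
    S.ratio w * Metric.ediam (S.wordMap w ⁻¹' A) ≤ Metric.ediam A := by
  have h0 := (S.ratio_word_pos w).ne'
  have : AntilipschitzWith (S.ratio w)⁻¹ (S.wordMap w) := AntilipschitzWith.of_le_mul_nndist
    fun x y => by rw [nndist_wordMap, inv_mul_cancel_left₀ h0]
  calc _ ≤ (S.ratio w : ℝ≥0∞) * ((S.ratio w)⁻¹ : ℝ≥0) * Metric.ediam A := by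
        rw [mul_assoc]; exact mul_le_mul_right (this.ediam_preimage_le A) _
    _ = Metric.ediam A := by rw [← ENNReal.coe_mul, mul_inv_cancel₀ h0]; simp

/-- The similitudes map intervals about a point to intervals about its image. -/
theorem ball_subset_wordMap_image (w : Word m) (z d : ℝ) :
    Metric.ball (S.wordMap w z) (S.ratio w * d) ⊆ S.wordMap w '' Metric.ball z d := by
  intro y hy
  obtain ⟨x, rfl⟩ := S.wordMap_surjective w y
  refine mem_image_of_mem _ ?_
  rw [Metric.mem_ball, dist_wordMap] at hy
  exact lt_of_mul_lt_mul_left hy (by positivity)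

theorem isOpen_wordMap_image (w : Word m) {A : Set ℝ} (hA : IsOpen A) :
    IsOpen (S.wordMap w '' A) := by
  rw [Metric.isOpen_iff] at hA ⊢
  rintro _ ⟨x, hx, rfl⟩
  obtain ⟨ε, hε, h⟩ := hA x hx
  exact ⟨S.ratio w * ε, mul_pos (by exact_mod_cast S.ratio_word_pos w) hε,
    (S.ball_subset_wordMap_image w x ε).trans (image_mono h)⟩

variable {S}

theorem UnitIntervalInvariant.wordMap_image_subset (h : S.UnitIntervalInvariant) (w : Word m) :
    S.wordMap w '' Ioo 0 1 ⊆ Ioo 0 1 := by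
  induction w with
  | nil => simp [wordMap]
  | cons j w ih =>
    rw [show S.wordMap (j :: w) = S.map j ∘ S.wordMap w from rfl, image_comp]
    exact (image_mono ih).trans (h j)

theorem wordMap_image_Icc_subset_closure (w : Word m) :
    S.wordMap w '' Icc 0 1 ⊆ closure (S.wordMap w '' Ioo 0 1) := by
  have := image_closure_subset_closure_image (s := Ioo (0 : ℝ) 1) (S.continuous_wordMap w)
  rwa [closure_Ioo zero_ne_one] at this

/-! ### The attractor -/

namespace IsAttractor

variable {K : Set ℝ} (hK : S.IsAttractor K)
include hK

theorem nonempty_index : Nonempty (Fin m) := by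
  obtain ⟨x, hx⟩ := hK.nonempty
  rw [hK.eq_iUnion] at hx
  exact ⟨(mem_iUnion.1 hx).choose⟩

theorem wordMap_image_subset (w : Word m) : S.wordMap w '' K ⊆ K := by
  induction w with
  | nil => simp [wordMap]
  | cons j w ih =>
    rw [show S.wordMap (j :: w) = S.map j ∘ S.wordMap w from rfl, image_comp]
    refine (image_mono ih).trans ?_
    conv_rhs => rw [hK.eq_iUnion]
    exact subset_iUnion (fun j => S.map j '' K) j

theorem exists_word_length (n : ℕ) {x : ℝ} (hx : x ∈ K) :
    ∃ w : Word m, w.length = n ∧ x ∈ S.wordMap w '' K := by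
  induction n generalizing x with
  | zero => exact ⟨[], rfl, by simpa [wordMap] using hx⟩
  | succ n ih =>
    rw [hK.eq_iUnion] at hx
    obtain ⟨j, y, hy, rfl⟩ := mem_iUnion.1 hx
    obtain ⟨w, hw, z, hz, rfl⟩ := ih hy
    exact ⟨j :: w, by simp [hw], z, hz, rfl⟩

theorem isCompact_wordMap_image (w : Word m) : IsCompact (S.wordMap w '' K) :=
  hK.isCompact.image (S.continuous_wordMap w)

/-- Every point of the attractor lies in copies of arbitrarily small ratio. -/
theorem exists_word_ratio_le {r : ℝ≥0} (hr : 0 < r) {x : ℝ} (hx : x ∈ K) :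
    ∃ w : Word m, S.ratio w ≤ r ∧ x ∈ S.wordMap w '' K := by
  obtain ⟨c, θ, -, -, hθ1, -, hθ⟩ := S.exists_uniform_ratio_bounds
  obtain ⟨n, hn⟩ := exists_pow_lt_of_lt_one hr hθ1
  obtain ⟨w, hw, hxw⟩ := hK.exists_word_length n hx
  exact ⟨w, (S.ratio_le_pow hθ w).trans (hw ▸ hn.le), hxw⟩

/-- Every point of the attractor lies in a copy of any prescribed approximate ratio. -/
theorem exists_word_ratio_mem {c : ℝ≥0} (hc : ∀ j, c ≤ ‖S.ρ j‖₊) {r : ℝ≥0} (hr : 0 < r)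
    (hr1 : r < 1) {x : ℝ} (hx : x ∈ K) :
    ∃ w : Word m, S.ratio w ≤ r ∧ c * r ≤ S.ratio w ∧ x ∈ S.wordMap w '' K := by
  classical
  have hex : ∃ n, ∃ w : Word m, w.length = n ∧ S.ratio w ≤ r ∧ x ∈ S.wordMap w '' K := by
    obtain ⟨w, h⟩ := hK.exists_word_ratio_le hr hx
    exact ⟨_, w, rfl, h⟩
  obtain ⟨w, hwn, hwr, hxw⟩ := Nat.find_spec hex
  refine ⟨w, hwr, ?_, hxw⟩
  rcases List.eq_nil_or_concat w with rfl | ⟨v, j, rfl⟩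
  · simp at hwr; exact absurd hr1 (not_lt.2 hwr)
  · rw [List.concat_eq_append] at *
    -- A word of least length works: dropping its last letter must raise the ratio above r, and one
    -- letter costs at most a factor c.
    have hv : r < S.ratio v := by
      by_contra! hv
      refine Nat.find_min hex (m := v.length) (by rw [← hwn]; simp) ⟨v, rfl, hv, ?_⟩
      rw [S.wordMap_append, image_comp] at hxw
      exact image_mono (hK.wordMap_image_subset [j]) hxw
    rw [S.ratio_append, mul_comm]
    exact mul_le_mul' hv.le (by simpa using hc j)

/-- The points `S_w(1/2)` lie in the open interval and approach each point of K as the copies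
containing it shrink. -/
theorem subset_Icc (h : S.UnitIntervalInvariant) : K ⊆ Icc 0 1 := by
  intro x hx
  have hcl : closure (Ioo (0 : ℝ) 1) = Icc 0 1 := closure_Ioo zero_ne_one
  rw [← hcl, Metric.mem_closure_iff]
  intro ε hε
  obtain ⟨C, hC⟩ := (hK.isCompact.isBounded.union (Metric.isBounded_Icc (0 : ℝ) 1)).subset_closedBall
    (1 / 2)
  obtain ⟨w, hw, y, hy, rfl⟩ := hK.exists_word_ratio_le
    (r := (ε / (|C| + 1)).toNNReal) (Real.toNNReal_pos.2 (by positivity)) hx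
  refine ⟨S.wordMap w (1 / 2), h.wordMap_image_subset w (mem_image_of_mem _ ⟨by norm_num,
    by norm_num⟩), ?_⟩
  rw [dist_wordMap]
  have h1 : dist y (1 / 2) ≤ C := hC (Or.inl hy)
  have h2 : (S.ratio w : ℝ) ≤ ε / (|C| + 1) := by
    rw [← Real.coe_toNNReal (ε / (|C| + 1)) (by positivity)]; exact_mod_cast hw
  calc S.ratio w * dist y (1 / 2) ≤ ε / (|C| + 1) * |C| := by
        gcongr; exact h1.trans (le_abs_self C)
    _ < ε / (|C| + 1) * (|C| + 1) := by gcongr; linarith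
    _ = ε := by field_simp

end IsAttractor

end LinearIFS

end LinearCantor

namespace LinearCantor

open Topology

namespace LinearIFS

variable {m : ℕ} {S : LinearIFS m}

namespace IsAttractor

variable {K : Set ℝ} (hK : S.IsAttractor K)
include hK

/-! ### Disjoint copies of the attractor -/

/-- If disjoint copies of `K` have total `s`-weight at least one, then finite covers of `K` have
`s`-weight bounded below by the gap between the copies. -/
theorem le_sum_ediam_rpow_of_one_le {s : ℝ} (hs : 0 ≤ s) {F : Finset (Word m)}
    (hF2 : F.Nontrivial) {δ : ℝ≥0∞} (hδ : ∀ v ∈ F, ∀ w ∈ F, v ≠ w →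
      ∀ x ∈ S.wordMap v '' K, ∀ y ∈ S.wordMap w '' K, δ ≤ edist x y)
    (hF : 1 ≤ ∑ w ∈ F, (S.ratio w : ℝ≥0∞) ^ s) (T : Finset ℕ) (U : ℕ → Set ℝ)
    (hT : K ⊆ ⋃ n ∈ T, U n) : δ ^ s ≤ ∑ n ∈ T, Metric.ediam (U n) ^ s := by
  classical
  induction T using Finset.strongInduction generalizing U with
  | H T ih =>
  -- Either some set of the cover bridges two copies and so has diameter at least δ, or the cover
  -- splits into disjoint subfamilies, one for each copy. Each subfamily is proper, as another copy
  -- needs sets too, so induction applies to its pullback.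
  by_cases hbig : ∃ n ∈ T, ∃ v ∈ F, ∃ w ∈ F, v ≠ w ∧ (U n ∩ S.wordMap v '' K).Nonempty ∧
      (U n ∩ S.wordMap w '' K).Nonempty
  · obtain ⟨n, hn, v, hv, w, hw, hvw, ⟨x, hx, hxv⟩, ⟨y, hy, hyw⟩⟩ := hbig
    calc δ ^ s ≤ Metric.ediam (U n) ^ s := by
          refine ENNReal.rpow_le_rpow ?_ hs
          exact (hδ v hv w hw hvw x hxv y hyw).trans (Metric.edist_le_ediam_of_mem hx hy)
      _ ≤ _ := Finset.single_le_sum (f := fun n => Metric.ediam (U n) ^ s)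
          (fun _ _ => zero_le) hn
  · set P : Word m → Finset ℕ := fun w => {n ∈ T | (U n ∩ S.wordMap w '' K).Nonempty} with hP
    have hPd : (F : Set (Word m)).PairwiseDisjoint P := by
      intro v hv w hw hvw
      rw [Function.onFun, Finset.disjoint_left]
      intro n hn hn'
      simp only [hP, Finset.mem_filter] at hn hn'
      exact hbig ⟨n, hn.1, v, hv, w, hw, hvw, hn.2, hn'.2⟩
    have hcov : ∀ w, S.wordMap w '' K ⊆ ⋃ n ∈ P w, U n := by
      intro w x hx
      obtain ⟨n, hn, hxn⟩ := mem_iUnion₂.1 (hT (hK.wordMap_image_subset w hx))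
      exact mem_iUnion₂.2 ⟨n, by simpa [hP] using ⟨hn, x, hxn, by simpa using hx⟩, hxn⟩
    have hne : ∀ w, (P w).Nonempty := by
      intro w
      obtain ⟨n, hn, -⟩ := mem_iUnion₂.1 (hcov w (hK.nonempty.image (S.wordMap w)).some_mem)
      exact ⟨n, hn⟩
    have hlt : ∀ w ∈ F, P w ⊂ T := by
      intro w hw
      obtain ⟨v, hv, hvw⟩ := hF2.exists_ne w
      obtain ⟨n, hn⟩ := hne v
      refine (Finset.ssubset_iff_of_subset (Finset.filter_subset _ _)).2
        ⟨n, (Finset.mem_filter.1 hn).1, Finset.disjoint_left.1 (hPd hv hw hvw) hn⟩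
    calc δ ^ s ≤ (∑ w ∈ F, (S.ratio w : ℝ≥0∞) ^ s) * δ ^ s := le_mul_of_one_le_left zero_le hF
      _ = ∑ w ∈ F, (S.ratio w : ℝ≥0∞) ^ s * δ ^ s := Finset.sum_mul _ _ _
      _ ≤ ∑ w ∈ F, ∑ n ∈ P w, Metric.ediam (U n) ^ s := by
        refine Finset.sum_le_sum fun w hw => ?_
        have := ih (P w) (hlt w hw) (fun n => S.wordMap w ⁻¹' U n) (by
          intro x hx
          simpa using hcov w (mem_image_of_mem _ hx))
        calc _ ≤ (S.ratio w : ℝ≥0∞) ^ s *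
              ∑ n ∈ P w, Metric.ediam (S.wordMap w ⁻¹' U n) ^ s := mul_le_mul_right this _
          _ ≤ _ := by
            rw [Finset.mul_sum]
            refine Finset.sum_le_sum fun n _ => ?_
            rw [← ENNReal.mul_rpow_of_nonneg _ _ hs]
            exact ENNReal.rpow_le_rpow (S.ratio_mul_ediam_preimage_le w _) hs
      _ = ∑ n ∈ F.biUnion P, Metric.ediam (U n) ^ s := (Finset.sum_biUnion hPd).symm
      _ ≤ ∑ n ∈ T, Metric.ediam (U n) ^ s :=
        Finset.sum_le_sum_of_subset (Finset.biUnion_subset.2 fun w hw => (hlt w hw).1)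

/-- Finitely many disjoint copies of `K` have total `α`-weight at most one, `α = dim_H K`. -/
theorem sum_ratio_rpow_le_one {α : ℝ≥0} (hα : dimH K = α) (F : Finset (Word m))
    (hF : (F : Set (Word m)).PairwiseDisjoint fun w => S.wordMap w '' K) :
    ∑ w ∈ F, (S.ratio w : ℝ≥0∞) ^ (α : ℝ) ≤ 1 := by
  by_contra! h
  have hF2 : F.Nontrivial := by
    rw [← Finset.one_lt_card_iff_nontrivial]
    have : ∑ w ∈ F, (S.ratio w : ℝ≥0∞) ^ (α : ℝ) ≤ F.card := by
      rw [← nsmul_one, ← Finset.sum_const]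
      exact Finset.sum_le_sum fun w _ =>
        ENNReal.rpow_le_one (by exact_mod_cast S.ratio_word_le_one w) α.2
    exact_mod_cast h.trans_le this
  -- The strict inequality at α persists slightly to the right of α.
  obtain ⟨s, hs1, hαs⟩ : ∃ s : ℝ, 1 < ∑ w ∈ F, (S.ratio w : ℝ≥0∞) ^ s ∧ (α : ℝ) < s :=
    (((tendsto_sum_rpow F S.ratio (fun w _ => (S.ratio_word_pos w).ne') α).mono_left
      nhdsWithin_le_nhds).eventually (lt_mem_nhds h) |>.and self_mem_nhdsWithin).exists
      (f := 𝓝[>] (α : ℝ))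
  have hs0 : 0 < s := α.2.trans_lt hαs
  lift s to ℝ≥0 using hs0.le
  obtain ⟨δ, hδ0, hδ⟩ : ∃ δ : ℝ≥0∞, δ ≠ 0 ∧ ∀ v ∈ F, ∀ w ∈ F, v ≠ w →
      ∀ x ∈ S.wordMap v '' K, ∀ y ∈ S.wordMap w '' K, δ ≤ edist x y := by
    have : ∀ p ∈ F ×ˢ F, ∀ᶠ δ : ℝ≥0∞ in 𝓝[>] 0, p.1 ≠ p.2 →
        ∀ x ∈ S.wordMap p.1 '' K, ∀ y ∈ S.wordMap p.2 '' K, δ ≤ edist x y := by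
      rintro ⟨v, w⟩ hp
      rw [Finset.mem_product] at hp
      by_cases hvw : v = w
      · exact Eventually.of_forall fun _ h => absurd hvw h
      obtain ⟨r, hr, h⟩ := Metric.exists_pos_forall_lt_edist (hK.isCompact_wordMap_image v)
        (hK.isCompact_wordMap_image w).isClosed (hF hp.1 hp.2 hvw)
      filter_upwards [Ioc_mem_nhdsGT (show (0 : ℝ≥0∞) < r from ENNReal.coe_pos.2 hr)] with δ hδ _ x hx y hy
      exact hδ.2.trans (h x hx y hy).le
    obtain ⟨δ, h, h0⟩ := (((Finset.eventually_all (F ×ˢ F)).2 this).and self_mem_nhdsWithin).exists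
    exact ⟨δ, (mem_Ioi.1 h0).ne', fun v hv w hw => h (v, w) (Finset.mk_mem_product hv hw)⟩
  have hpos : μH[(s : ℝ)] K ≠ 0 := by
    intro h0
    have hδs : δ ^ (s : ℝ) ≠ 0 := by simp [ENNReal.rpow_eq_zero_iff, hδ0]
    obtain ⟨T, U, r, hT, -, hr, hsum⟩ :=
      exists_finite_cover_of_hausdorffMeasure_eq_zero hs0 hK.isCompact h0 hδs
    refine (hsum.trans_le (hK.le_sum_ediam_rpow_of_one_le hs0.le hF2 hδ hs1.le T U hT)).not_ge ?_
    exact Finset.sum_le_sum fun n _ => ENNReal.rpow_le_rpow (hr n) hs0.le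
  have := le_dimH_of_hausdorffMeasure_ne_zero hpos
  rw [hα, ENNReal.coe_le_coe] at this
  exact hαs.not_ge (NNReal.coe_le_coe.2 this)

/-- An attractor of dimension zero is a singleton. -/
theorem subsingleton_of_dimH_eq_zero (hα : dimH K = 0) : K.Subsingleton := by
  intro x hx y hy
  by_contra hxy
  have hd : 0 < nndist x y := pos_iff_ne_zero.2 fun h => hxy (nndist_eq_zero.1 h)
  set D : ℝ≥0 := (Metric.ediam K).toNNReal with hD
  have hDK : ∀ a ∈ K, ∀ b ∈ K, nndist a b ≤ D := fun a ha b hb => by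
    rw [← ENNReal.coe_le_coe, hD, ENNReal.coe_toNNReal hK.isCompact.isBounded.ediam_ne_top,
      ← edist_nndist]
    exact Metric.edist_le_ediam_of_mem ha hb
  -- Copies this small have diameter at most a quarter of the distance, so those around x and y are
  -- disjoint.
  have hr : 0 < nndist x y / (4 * (D + 1)) := by positivity
  obtain ⟨v, hv, a, ha, rfl⟩ := hK.exists_word_ratio_le hr hx
  obtain ⟨w, hw, b, hb, rfl⟩ := hK.exists_word_ratio_le hr hy
  set d := nndist (S.wordMap v a) (S.wordMap w b)
  have key : ∀ u, S.ratio u ≤ d / (4 * (D + 1)) → ∀ p ∈ K, ∀ q ∈ K,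
      nndist (S.wordMap u p) (S.wordMap u q) ≤ d / 4 := by
    intro u hu p hp q hq
    rw [nndist_wordMap]
    calc _ ≤ d / (4 * (D + 1)) * (D + 1) :=
          mul_le_mul' hu ((hDK p hp q hq).trans (le_add_of_nonneg_right zero_le))
      _ = d / 4 := by field_simp
  have hdisj : Disjoint (S.wordMap v '' K) (S.wordMap w '' K) := by
    rw [Set.disjoint_left]
    rintro _ ⟨p, hp, rfl⟩ ⟨q, hq, hpq⟩
    have h1 := key v hv a ha p hp
    have h2 := key w hw q hq b hb
    rw [hpq] at h2
    have h3 : d ≤ d / 4 + d / 4 := (nndist_triangle _ (S.wordMap v p) _).trans (add_le_add h1 h2)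
    rw [← NNReal.coe_le_coe] at h3
    push_cast at h3
    have h4 : (0 : ℝ) < d := by exact_mod_cast hd
    linarith
  have hvw : v ≠ w := by
    rintro rfl
    exact (hK.nonempty.image _).ne_empty (disjoint_self.1 hdisj)
  -- At exponent zero every copy has weight 1, so two disjoint copies violate the bound.
  have := hK.sum_ratio_rpow_le_one (α := 0) (by simpa using hα) {v, w} (by
    rw [Finset.coe_pair]
    exact pairwise_pair.2 fun _ => ⟨hdisj, hdisj.symm⟩)
  rw [Finset.sum_pair hvw] at this
  norm_num at this

/-! ### Hausdorff measure and Hausdorff content -/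

/-- The `α`-dimensional Hausdorff measure of `K`, `α = dim_H K`, is at most the weight of any cover
of `K`, whatever the sizes of its members. -/
theorem hausdorffMeasure_le_tsum {α : ℝ≥0} (hα : dimH K = α) (hα0 : 0 < α) (U : ℕ → Set ℝ)
    (hU : K ⊆ ⋃ n, U n) : μH[(α : ℝ)] K ≤ ∑' n, Metric.ediam (U n) ^ (α : ℝ) := by
  obtain ⟨z, hz⟩ := hK.nonempty
  have hα' : (0 : ℝ) < α := hα0
  set D : ℝ≥0 := (Metric.ediam K).toNNReal with hD
  have hDK : (D : ℝ≥0∞) = Metric.ediam K :=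
    ENNReal.coe_toNNReal hK.isCompact.isBounded.ediam_ne_top
  have hdist : ∀ a ∈ K, ∀ b ∈ K, dist a b ≤ D := fun a ha b hb => by
    rw [← coe_nndist, NNReal.coe_le_coe, ← ENNReal.coe_le_coe, hDK, ← edist_nndist]
    exact Metric.edist_le_ediam_of_mem ha hb
  have key : ∀ N : ℕ, ∃ (u : Set (Word m)) (v : Finset u), (∀ w ∈ u, S.ratio w ≤ 1 / ((N : ℝ≥0) + 1)) ∧
      (∑ w ∈ v, (S.ratio w : ℝ≥0∞) ^ (α : ℝ) ≤ 1) ∧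
      (∑' w : {w // w ∉ v}, (S.ratio (w : u) : ℝ≥0∞) ^ (α : ℝ) ≤ ((N : ℝ≥0∞) + 1)⁻¹) ∧
      K ⊆ (⋃ w ∈ v, S.wordMap w '' K) ∪
        ⋃ w : {w // w ∉ v}, Metric.closedBall (S.wordMap (w : u) z) (S.ratio (w : u) * (3 * D)) := by
    intro N
    -- Vitali's selection among all small copies. The disjoint family has finite weight, so all but
    -- a finite part `v` has weight at most `1/(N+1)`.
    obtain ⟨u, hut, hud, hu⟩ := Vitali.exists_disjoint_subfamily_covering_enlargement
      (fun w => S.wordMap w '' K) {w | S.ratio w ≤ 1 / ((N : ℝ≥0) + 1)} (fun w => (S.ratio w : ℝ)) 2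
      one_lt_two (fun _ _ => NNReal.coe_nonneg _) 1
      (fun w _ => by exact_mod_cast S.ratio_word_le_one w) (fun w _ => hK.nonempty.image _)
    have hfin : ∀ v : Finset u, ∑ w ∈ v, (S.ratio w : ℝ≥0∞) ^ (α : ℝ) ≤ 1 := fun v => by
      have := hK.sum_ratio_rpow_le_one hα (v.map (Function.Embedding.subtype _))
        (hud.subset (by intro w hw; obtain ⟨a, -, rfl⟩ := Finset.mem_map.1 hw; exact a.2))
      simpa using this
    have hsum : ∑' w : u, (S.ratio w : ℝ≥0∞) ^ (α : ℝ) ≠ ∞ := by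
      rw [ENNReal.tsum_eq_iSup_sum]
      exact ((iSup_le hfin).trans_lt ENNReal.one_lt_top).ne
    obtain ⟨v, hv⟩ := ((ENNReal.tendsto_tsum_compl_atTop_zero hsum).eventually_le_const
      (u := ((N : ℝ≥0∞) + 1)⁻¹) (by simp)).exists
    refine ⟨u, v, fun w hw => hut hw, hfin v, hv, fun x hx => ?_⟩
    by_cases hxv : x ∈ ⋃ w ∈ v, S.wordMap w '' K
    · exact Or.inl hxv
    right
    have hcl : IsClosed (⋃ w ∈ v, S.wordMap w '' K) :=
      v.finite_toSet.isClosed_biUnion fun w _ => (hK.isCompact_wordMap_image w).isClosed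
    obtain ⟨ε, hε, hball⟩ := Metric.isOpen_iff.1 hcl.isOpen_compl x hxv
    -- The copy around x is small enough to miss the finite part, so the selected copy it meets lies
    -- in the tail. The radius `3D` is 2D for the copy `a`, of ratio at most twice that of `b`, plus
    -- D for `b`.
    obtain ⟨a, ha, y, hy, rfl⟩ := hK.exists_word_ratio_le
      (r := min (1 / ((N : ℝ≥0) + 1)) (ε.toNNReal / (D + 1)))
      (lt_min (by positivity) (by have := Real.toNNReal_pos.2 hε; positivity)) hx
    obtain ⟨b, hbu, ⟨p, ⟨q, hq, rfl⟩, ⟨q', hq', hqq⟩⟩, hab⟩ := hu a (ha.trans (min_le_left _ _))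
    have hbv : (⟨b, hbu⟩ : u) ∉ v := by
      intro hbv
      refine hball (a := S.wordMap a q) ?_ (mem_iUnion₂.2 ⟨⟨b, hbu⟩, hbv, q', hq', hqq⟩)
      rw [Metric.mem_ball, dist_wordMap]
      have h1 : (S.ratio a : ℝ) ≤ ε / (D + 1) := by
        have := ha.trans (min_le_right _ _)
        rw [← NNReal.coe_le_coe] at this
        simpa [hε.le] using this
      calc S.ratio a * dist q y ≤ ε / (D + 1) * D := by gcongr; exact hdist q hq y hy
        _ < ε / (D + 1) * (D + 1) := by gcongr; linarith
        _ = ε := by field_simp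
    refine mem_iUnion.2 ⟨⟨⟨b, hbu⟩, hbv⟩, ?_⟩
    rw [Metric.mem_closedBall]
    calc dist (S.wordMap a y) (S.wordMap b z)
        ≤ dist (S.wordMap a y) (S.wordMap a q) + dist (S.wordMap a q) (S.wordMap b z) :=
          dist_triangle _ _ _
      _ = S.ratio a * dist y q + S.ratio b * dist q' z := by rw [← hqq, dist_wordMap, hqq, dist_wordMap]
      _ ≤ 2 * S.ratio b * D + S.ratio b * D := by
        gcongr
        · exact hdist y hy q hq
        · exact hdist q' hq' z hz
      _ = _ := by ring
  choose u v hu hv htail hcov using key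
  have hlim : Tendsto (fun N : ℕ => ((N : ℝ≥0∞) + 1)⁻¹) atTop (𝓝 0) := by
    have := ENNReal.tendsto_inv_nat_nhds_zero.comp (tendsto_add_atTop_nat 1)
    simpa [Function.comp_def] using this
  have hsmall : ∀ N, ∀ w ∈ u N, (S.ratio w : ℝ≥0∞) ≤ ((N : ℝ≥0∞) + 1)⁻¹ := fun N w hw => by
    have := ENNReal.coe_le_coe.2 (hu N w hw)
    rwa [one_div, ENNReal.coe_inv (by positivity)] at this
  have hballdiam : ∀ w, Metric.ediam (Metric.closedBall (S.wordMap w z) (S.ratio w * (3 * D))) ≤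
      S.ratio w * (6 * D) := fun w => by
    refine Metric.ediam_le fun x hx y hy => ?_
    have h : nndist x y ≤ S.ratio w * (6 * D) := by
      rw [← NNReal.coe_le_coe]
      push_cast
      linarith [dist_triangle_right x y (S.wordMap w z), Metric.mem_closedBall.1 hx,
        Metric.mem_closedBall.1 hy]
    rw [edist_nndist]
    exact_mod_cast h
  -- Each copy in `v` receives an image of the given cover, cut down to K so that its diameters
  -- shrink with the copy; balls cover the rest.
  refine (Measure.hausdorffMeasure_le_liminf_tsum (α : ℝ) K (l := atTop)
    (fun N : ℕ => ((N : ℝ≥0∞) + 1)⁻¹ * (6 * D)) ?_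
    (ι := fun N => ((v N) × ℕ) ⊕ {w // w ∉ v N})
    (fun N => Sum.elim (fun p => S.wordMap p.1 '' (U p.2 ∩ K))
      (fun w => Metric.closedBall (S.wordMap (w : u N) z) (S.ratio (w : u N) * (3 * D))))
    (Eventually.of_forall fun N => ?_) (Eventually.of_forall fun N => ?_)).trans ?_
  · simpa using ENNReal.Tendsto.mul_const hlim (Or.inr (by finiteness))
  · rintro (⟨w, n⟩ | w)
    · refine (S.ediam_wordMap_image_le _ _).trans (mul_le_mul' (hsmall N _ w.1.2) ?_)
      calc Metric.ediam (U n ∩ K) ≤ Metric.ediam K := Metric.ediam_mono inter_subset_right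
        _ = 1 * D := by rw [hDK, one_mul]
        _ ≤ 6 * D := by gcongr; norm_num
    · exact (hballdiam _).trans (mul_le_mul_left (hsmall N _ w.1.2) _)
  · intro x hx
    rcases hcov N hx with h | h
    · obtain ⟨w, hw, y, hy, rfl⟩ := mem_iUnion₂.1 h
      obtain ⟨n, hn⟩ := mem_iUnion.1 (hU hy)
      exact mem_iUnion.2 ⟨Sum.inl (⟨w, hw⟩, n), y, ⟨hn, hy⟩, rfl⟩
    · obtain ⟨w, hw⟩ := mem_iUnion.1 h
      exact mem_iUnion.2 ⟨Sum.inr w, hw⟩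
  · have hle : ∀ N, (∑' i : ((v N) × ℕ) ⊕ {w // w ∉ v N}, Metric.ediam
        (Sum.elim (fun p : v N × ℕ => S.wordMap p.1 '' (U p.2 ∩ K))
        (fun w : {w // w ∉ v N} => Metric.closedBall (S.wordMap (w : u N) z)
          (S.ratio (w : u N) * (3 * D))) i) ^ (α : ℝ)) ≤
        ∑' n, Metric.ediam (U n) ^ (α : ℝ) + ((N : ℝ≥0∞) + 1)⁻¹ * (6 * D) ^ (α : ℝ) := by
      intro N
      rw [Summable.tsum_sum ENNReal.summable ENNReal.summable]
      refine add_le_add ?_ ?_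
      · simp only [Sum.elim_inl]
        rw [ENNReal.tsum_prod (f := fun (w : v N) (n : ℕ) =>
          Metric.ediam (S.wordMap w '' (U n ∩ K)) ^ (α : ℝ))]
        calc _ ≤ ∑' w : v N, (S.ratio w : ℝ≥0∞) ^ (α : ℝ) * ∑' n, Metric.ediam (U n) ^ (α : ℝ) := by
              refine ENNReal.tsum_le_tsum fun w => ?_
              rw [← ENNReal.tsum_mul_left]
              refine ENNReal.tsum_le_tsum fun n => ?_
              rw [← ENNReal.mul_rpow_of_nonneg _ _ hα'.le]
              refine ENNReal.rpow_le_rpow ((S.ediam_wordMap_image_le _ _).trans ?_) hα'.le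
              gcongr
              exact inter_subset_left
          _ = (∑ w ∈ v N, (S.ratio w : ℝ≥0∞) ^ (α : ℝ)) * ∑' n, Metric.ediam (U n) ^ (α : ℝ) := by
              rw [ENNReal.tsum_mul_right, Finset.tsum_subtype (v N)
                (fun w => (S.ratio w : ℝ≥0∞) ^ (α : ℝ))]
          _ ≤ _ := mul_le_of_le_one_left zero_le (hv N)
      · simp only [Sum.elim_inr]
        calc _ ≤ ∑' w : {w // w ∉ v N}, (S.ratio (w : u N) : ℝ≥0∞) ^ (α : ℝ) * (6 * D) ^ (α : ℝ) := by
              refine ENNReal.tsum_le_tsum fun w => ?_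
              rw [← ENNReal.mul_rpow_of_nonneg _ _ hα'.le]
              exact ENNReal.rpow_le_rpow (hballdiam _) hα'.le
          _ ≤ _ := by rw [ENNReal.tsum_mul_right]; exact mul_le_mul_left (htail N) _
    have hfin : ((6 : ℝ≥0∞) * D) ^ (α : ℝ) ≠ ∞ := ENNReal.rpow_ne_top_of_nonneg hα'.le (by finiteness)
    have := (ENNReal.Tendsto.mul_const hlim (Or.inr hfin)).const_add
      (∑' n, Metric.ediam (U n) ^ (α : ℝ))
    rw [zero_mul, add_zero] at this
    rw [← this.liminf_eq]
    exact liminf_le_liminf (Eventually.of_forall hle)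

end IsAttractor

end LinearIFS

end LinearCantor

namespace LinearCantor

open Topology

namespace LinearIFS

variable {m : ℕ} {S : LinearIFS m} {M : ℕ → Finset (Word m)}

open scoped Pointwise

/-! ### Finiteness of the relative positions of overlapping copies -/

variable (S M)

/-- The maps `S_p⁻¹ ∘ S_q`, where `p`, `q` run over the pairs of words of a common index set whose
open intervals meet. -/
def overlapMaps : Set (Equiv.Perm ℝ) :=
  {h | ∃ k, ∃ p ∈ M k, ∃ q ∈ M k, (S.wordMap p '' Ioo 0 1 ∩ S.wordMap q '' Ioo 0 1).Nonempty ∧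
    h = (S.wordPerm p)⁻¹ * S.wordPerm q}

theorem finite_islandMaps (k : ℕ) (I : Set ℝ) : (S.islandMaps M k I).Finite :=
  ((M k).finite_toSet.image S.wordMap).subset fun _ ⟨i, hi, h, _⟩ => ⟨i, hi, h⟩

/-- Words of a common index set whose open intervals meet belong to a common island. -/
theorem exists_island_of_overlap {k : ℕ} {p q : Word m} (hp : p ∈ M k) (hq : q ∈ M k)
    (h : (S.wordMap p '' Ioo 0 1 ∩ S.wordMap q '' Ioo 0 1).Nonempty) :
    ∃ I : S.Island M, S.wordMap p ∈ S.islandMaps M I.gen I.carrier ∧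
      S.wordMap q ∈ S.islandMaps M I.gen I.carrier := by
  obtain ⟨y, hyp, hyq⟩ := h
  have hsub : ∀ i ∈ M k, S.wordMap i '' Ioo 0 1 ⊆ S.levelOpen M k := fun i hi =>
    subset_iUnion₂ (s := fun i (_ : i ∈ M k) => S.wordMap i '' Ioo (0 : ℝ) 1) i hi
  have hcl : ∀ i ∈ M k, y ∈ S.wordMap i '' Ioo 0 1 →
      S.wordMap i ∈ S.islandMaps M k (closure (connectedComponentIn (S.levelOpen M k) y)) := by
    intro i hi hyi
    refine ⟨i, hi, rfl, (wordMap_image_Icc_subset_closure i).trans (closure_mono ?_)⟩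
    exact (isPreconnected_Ioo.image _ (S.continuous_wordMap i).continuousOn
      ).subset_connectedComponentIn hyi (hsub i hi)
  exact ⟨⟨k, _, y, hsub p hp hyp, rfl⟩, hcl p hp hyp, hcl q hq hyq⟩

/-- An equivalence of islands composes all their maps on the left with one affine map, which cancels
in `S_p⁻¹ S_q`. Only the finitely many pairs of maps of one island per type matter, and `f ∘ h = g`
with f injective determines h. -/
theorem finite_overlapMaps [Finite (S.OverlapType M)] : (S.overlapMaps M).Finite := by
  have hV : ∀ T : S.OverlapType M, (S.islandMaps M (Quotient.out T).gen
    (Quotient.out T).carrier).Finite := fun T => S.finite_islandMaps M _ _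
  refine (finite_iUnion fun T : S.OverlapType M => (hV T).biUnion fun f _ => (hV T).biUnion
    fun g _ => (?_ : {h : Equiv.Perm ℝ | Function.Injective f ∧ f ∘ h = g}.Finite)).subset ?_
  · refine Set.Subsingleton.finite fun h hh h' hh' => ?_
    ext x
    exact hh.1 (congrFun (hh.2.trans hh'.2.symm) x)
  · rintro h ⟨k, p, hp, q, hq, hpq, rfl⟩
    obtain ⟨I, hpI, hqI⟩ := S.exists_island_of_overlap M hp hq hpq
    obtain ⟨a, c, ha, -, hV', -⟩ : (Quotient.out I.overlapType).Equivalent I :=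
      Quotient.exact (s := S.islandSetoid M) (Quotient.out_eq I.overlapType)
    rw [hV'] at hpI hqI
    obtain ⟨f, hf, hfp⟩ := hpI
    obtain ⟨g, hg, hgq⟩ := hqI
    have hτ : Function.Injective fun x : ℝ => a * x + c := fun x y hxy => by
      simpa [ha] using hxy
    refine mem_iUnion.2 ⟨I.overlapType, mem_iUnion₂.2 ⟨f, hf, mem_iUnion₂.2 ⟨g, hg, ?_, ?_⟩⟩⟩
    · have := S.wordMap_injective p
      rw [← hfp] at this
      exact this.of_comp
    · funext x
      apply hτ
      have h1 := congrFun hfp ((S.wordPerm p)⁻¹ (S.wordPerm q x))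
      have h2 := congrFun hgq x
      rw [← S.coe_wordPerm] at h1 h2
      exact h1.trans ((Equiv.apply_symm_apply (S.wordPerm p) _).trans h2.symm)

/-- Overlapping words of a common index set have comparable ratios. -/
theorem exists_ratio_le_of_overlap [Finite (S.OverlapType M)] : ∃ B : ℝ≥0, 0 < B ∧
    ∀ k, ∀ p ∈ M k, ∀ q ∈ M k, (S.wordMap p '' Ioo 0 1 ∩ S.wordMap q '' Ioo 0 1).Nonempty →
      S.ratio q ≤ B * S.ratio p := by
  -- The quotient of the two ratios is the distance between `h 1` and `h 0`, where `h = S_p⁻¹ S_q`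
  -- ranges over a finite set.
  obtain ⟨B, hB⟩ := ((S.finite_overlapMaps M).image fun h => nndist (h 1) (h 0)).bddAbove
  refine ⟨B + 1, by positivity, fun k p hp q hq hpq => ?_⟩
  have h := hB (mem_image_of_mem _ ⟨k, p, hp, q, hq, hpq, rfl⟩)
  have h2 : S.ratio q = S.ratio p * nndist (((S.wordPerm p)⁻¹ * S.wordPerm q) 1)
      (((S.wordPerm p)⁻¹ * S.wordPerm q) 0) := by
    have hinv : ∀ x, S.wordMap p (((S.wordPerm p)⁻¹ * S.wordPerm q) x) = S.wordMap q x := fun x => by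
      rw [← S.coe_wordPerm, ← S.coe_wordPerm]
      exact Equiv.apply_symm_apply (S.wordPerm p) _
    rw [← nndist_wordMap, hinv, hinv, nndist_wordMap]
    simp [nndist_eq_nnnorm]
  rw [h2, mul_comm]
  exact mul_le_mul_left (h.trans (le_add_of_nonneg_right zero_le)) _

/-! ### Comparing arbitrary words with the index sets -/

variable {M}

/-- Every word has an initial segment in some index set that is shorter by at most a constant. -/
theorem _root_.LinearCantor.IsNestedIndexSequence.exists_prefix_length_le [Nonempty (Fin m)]
    (hM : IsNestedIndexSequence M) : ∃ L : ℕ, ∀ w : Word m, ∃ k, ∃ p ∈ M k, p <+: w ∧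
      w.length ≤ p.length + L := by
  classical
  obtain ⟨L, -, hL⟩ := hM.bounded_step
  refine ⟨L, fun w => ?_⟩
  obtain ⟨k₀, hk₀⟩ := (hM.minLength_tendsto.eventually_gt_atTop w.length).exists
  -- The padding makes the word long enough to have an initial segment in every `M k` with `k ≤ k₀`.
  -- At the first generation where that segment outgrows `w`, the preceding one is still an initial
  -- segment of `w`, and the step between them is at most L.
  set v : Word m := w ++ List.replicate (maxLength (M k₀) + 1) (Classical.arbitrary (Fin m))
  have hv : ∀ k ≤ k₀, ∃ p ∈ M k, p <+: v := fun k hk => hM.exists_prefix k v (by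
    have : maxLength (M k) ≤ maxLength (M k₀) := hM.maxLength_mono hk
    simp only [v, List.length_append, List.length_replicate]
    omega)
  have hex : ∃ k, ∃ p ∈ M k, p <+: v ∧ w.length < p.length := by
    obtain ⟨p, hp, hpv⟩ := hv k₀ le_rfl
    exact ⟨k₀, p, hp, hpv, hk₀.trans_le (Nat.sInf_le (mem_image_of_mem _ hp))⟩
  obtain ⟨p, hp, hpv, hwp⟩ := Nat.find_spec hex
  have hle : Nat.find hex ≤ k₀ := Nat.find_min' hex (by
    obtain ⟨p, hp, hpv⟩ := hv k₀ le_rfl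
    exact ⟨p, hp, hpv, hk₀.trans_le (Nat.sInf_le (mem_image_of_mem _ hp))⟩)
  obtain ⟨k, hk⟩ : ∃ k, Nat.find hex = k + 1 := by
    refine Nat.exists_eq_succ_of_ne_zero fun h0 => ?_
    rw [h0, hM.zero, Finset.mem_singleton] at hp
    simp [hp] at hwp
  obtain ⟨q, hq, hqv⟩ := hv k (by omega)
  have hqw : q.length ≤ w.length := by
    by_contra! h
    exact Nat.find_min hex (m := k) (by omega) ⟨q, hq, hqv, h⟩
  refine ⟨k, q, hq, List.prefix_of_prefix_length_le hqv (List.prefix_append _ _) hqw, ?_⟩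
  have := hL k q hq p (hk ▸ hp) (List.prefix_of_prefix_length_le hqv hpv (by omega))
  omega

variable {S}

/-- The points of a copy of the attractor lie in copies given by words of a prescribed index set
that are comparable with the word of that copy. -/
theorem IsAttractor.exists_comparable_word {K : Set ℝ} (hK : S.IsAttractor K)
    (hM : IsNestedIndexSequence M) (k : ℕ) (w : Word m) {y : ℝ} (hy : y ∈ S.wordMap w '' K) :
    ∃ q ∈ M k, y ∈ S.wordMap q '' K ∧ (q <+: w ∨ w <+: q) := by
  obtain ⟨x, hx, rfl⟩ := hy
  obtain ⟨v, hv, z, hz, rfl⟩ := hK.exists_word_length (maxLength (M k) + 1) hx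
  obtain ⟨q, hq, u, hu⟩ := hM.exists_prefix k (w ++ v) (by simp [hv]; omega)
  refine ⟨q, hq, ⟨S.wordMap u z, hK.wordMap_image_subset u (mem_image_of_mem _ hz), ?_⟩,
    List.prefix_or_prefix_of_prefix ⟨u, hu⟩ (List.prefix_append _ _)⟩
  have := S.wordMap_append q u
  rw [hu, S.wordMap_append] at this
  exact (congrFun this z).symm

/-- The relative positions of copies of comparable ratios, the open interval of the first meeting
the second copy of the attractor, form a finite set. -/
theorem IsAttractor.finite_neighborMaps {K : Set ℝ} (hK : S.IsAttractor K)
    (hM : S.IsGeneralizedFiniteType M) (C : ℝ≥0) :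
    {h : Equiv.Perm ℝ | ∃ v w : Word m, S.ratio v ≤ C * S.ratio w ∧ S.ratio w ≤ C * S.ratio v ∧
      (S.wordMap v '' Ioo 0 1 ∩ S.wordMap w '' K).Nonempty ∧
      h = (S.wordPerm v)⁻¹ * S.wordPerm w}.Finite := by
  have := hM.finite_types
  have := hK.nonempty_index
  obtain ⟨L, hL⟩ := hM.nested.exists_prefix_length_le
  obtain ⟨B, hB0, hB⟩ := S.exists_ratio_le_of_overlap M
  obtain ⟨c, θ, hc0, hc1, hθ1, hc, hθ⟩ := S.exists_uniform_ratio_bounds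
  have hcL : 0 < c ^ L := pow_pos hc0 L
  have hE : {u : Word m | c ^ L ≤ B * C * S.ratio u}.Finite := by
    have hlim : Tendsto (fun n : ℕ => B * C * θ ^ n) atTop (𝓝 0) := by
      simpa using (tendsto_pow_atTop_nhds_zero_of_lt_one (zero_le) hθ1).const_mul (B * C)
    obtain ⟨n₀, hn₀⟩ := eventually_atTop.1 (hlim.eventually_lt_const hcL)
    refine (List.finite_length_lt (Fin m) n₀).subset fun u hu => ?_
    by_contra! h
    exact (hn₀ _ (not_lt.1 h)).not_ge (hu.trans (mul_le_mul_right (S.ratio_le_pow hθ u) _))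
  have hU := (List.finite_length_le (Fin m) L).image S.wordPerm
  have hΓ := S.finite_overlapMaps M
  -- With `v = p u` and `q` comparable to `w`, `S_v⁻¹ S_w = S_u⁻¹ (S_p⁻¹ S_q) (S_q⁻¹ S_w)`. The last
  -- factor is `S_t` or `S_t⁻¹`, according to which of `q`, `w` is the shorter. Here `u` is short,
  -- and comparability of the ratios bounds that of `t` from below.
  refine (((hU.inv.mul hΓ).mul (hE.image S.wordPerm)).union
    ((hU.inv.mul hΓ).mul (hE.image S.wordPerm).inv)).subset ?_
  rintro _ ⟨v, w, hvw, hwv, ⟨y, hyv, hyw⟩, rfl⟩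
  obtain ⟨k, p, hp, ⟨u, rfl⟩, hlen⟩ := hL v
  have hu : u.length ≤ L := by simpa using hlen
  obtain ⟨q, hq, hyq, hqw⟩ := hK.exists_comparable_word hM.nested k w hyw
  have hover : (S.wordMap p '' Ioo 0 1 ∩ S.wordMap q '' Ioo 0 1).Nonempty := by
    have h1 : y ∈ S.wordMap p '' Ioo 0 1 := by
      rw [S.wordMap_append, image_comp] at hyv
      exact image_mono (hM.invariant.wordMap_image_subset u) hyv
    have h2 : y ∈ closure (S.wordMap q '' Ioo 0 1) :=
      wordMap_image_Icc_subset_closure q (image_mono (hK.subset_Icc hM.invariant) hyq)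
    exact mem_closure_iff.1 h2 _ (S.isOpen_wordMap_image p isOpen_Ioo) h1
  have hpq := hB k p hp q hq hover
  have hqp := hB k q hq p hp (by rwa [inter_comm])
  have hru : c ^ L ≤ S.ratio u :=
    (pow_le_pow_of_le_one zero_le hc1 hu).trans (S.pow_le_ratio hc u)
  rw [ratio_append] at hvw hwv
  have hmem : (S.wordPerm u)⁻¹ * ((S.wordPerm p)⁻¹ * S.wordPerm q) ∈
      (S.wordPerm '' {l : Word m | l.length ≤ L})⁻¹ * S.overlapMaps M :=
    mul_mem_mul (Set.inv_mem_inv.2 (mem_image_of_mem _ hu)) ⟨k, p, hp, q, hq, hover, rfl⟩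
  rcases hqw with ⟨t, rfl⟩ | ⟨t, rfl⟩
  · left
    have ht : t ∈ {u : Word m | c ^ L ≤ B * C * S.ratio u} := by
      rw [mem_ofPred_eq]
      rw [ratio_append] at hvw hwv
      have h0 := S.ratio_word_pos q
      refine le_of_mul_le_mul_left ?_ h0
      calc S.ratio q * c ^ L ≤ B * S.ratio p * S.ratio u := mul_le_mul' hpq hru
        _ = B * (S.ratio p * S.ratio u) := mul_assoc _ _ _
        _ ≤ B * (C * (S.ratio q * S.ratio t)) := mul_le_mul_right hvw _
        _ = _ := by ring
    have := Set.mul_mem_mul hmem (mem_image_of_mem S.wordPerm ht)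
    convert this using 1
    simp only [wordPerm_append]
    group
  · right
    have ht : t ∈ {u : Word m | c ^ L ≤ B * C * S.ratio u} := by
      rw [mem_ofPred_eq]
      have h0 := S.ratio_word_pos w
      refine le_of_mul_le_mul_left ?_ h0
      rw [ratio_append] at hqp
      calc S.ratio w * c ^ L ≤ C * (S.ratio p * S.ratio u) * 1 :=
            mul_le_mul' hwv (pow_le_one' hc1 L)
        _ ≤ C * (B * (S.ratio w * S.ratio t) * 1) * 1 := by
            gcongr; exact S.ratio_word_le_one u
        _ = _ := by ring
    have := Set.mul_mem_mul hmem (Set.inv_mem_inv.2 (mem_image_of_mem S.wordPerm ht))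
    convert this using 1
    simp only [wordPerm_append]
    group

/-- **Weak separation.** The part of the attractor in a set of diameter at most `r` is covered by a
bounded number of copies of ratio at most `r`. -/
theorem IsAttractor.exists_card_le_cover {K : Set ℝ} (hK : S.IsAttractor K)
    (hM : S.IsGeneralizedFiniteType M) {z : ℝ} (hzK : z ∈ K) (hz : z ∈ Ioo 0 1) :
    ∃ N : ℕ, ∀ r : ℝ≥0, 0 < r → r < 1 → ∀ U : Set ℝ, Metric.ediam U ≤ r →
      ∃ F : Finset (Word m), F.card ≤ N ∧ (∀ w ∈ F, S.ratio w ≤ r) ∧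
        K ∩ U ⊆ ⋃ w ∈ F, S.wordMap w '' K := by
  classical
  obtain ⟨c, θ, hc0, hc1, -, hc, -⟩ := S.exists_uniform_ratio_bounds
  obtain ⟨d, hd0, hd⟩ := Metric.isOpen_iff.1 isOpen_Ioo z hz
  have hcR : (0 : ℝ) < c := hc0
  have hΔ := hK.finite_neighborMaps hM c⁻¹
  set Q : ℤ := ⌈2 / (c * d)⌉ + 1 with hQ
  refine ⟨(Finset.Icc (-Q) Q ×ˢ hΔ.toFinset).card, fun r hr0 hr1 U hU => ?_⟩
  have hrR : (0 : ℝ) < r := hr0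
  rcases (K ∩ U).eq_empty_or_nonempty with h | ⟨x₀, hx₀K, hx₀U⟩
  · exact ⟨∅, by simp, by simp, by simp [h]⟩
  set A : Set (Word m) := {w | S.ratio w ≤ r ∧ c * r ≤ S.ratio w ∧
    (S.wordMap w '' K ∩ U).Nonempty} with hA
  -- Cells have length `c d r`: if `S_v z` and `S_w z` share one, then `S_w z` lies in `S_v` of the
  -- d-ball about z, hence in `S_v((0,1))`, and the pair is a neighbour pair.
  set cell : Word m → ℤ := fun w => ⌊(S.wordMap w z - x₀) / (c * d * r)⌋ with hcell
  have hcdr : 0 < c * d * r := by positivity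
  have hcellQ : ∀ w ∈ A, cell w ∈ Finset.Icc (-Q) Q := by
    rintro w ⟨hwr, -, _, ⟨y, hy, rfl⟩, hyU⟩
    have h1 : dist (S.wordMap w z) x₀ ≤ 2 * r := by
      have h2 : dist (S.wordMap w z) (S.wordMap w y) ≤ r * 1 := by
        rw [dist_wordMap]
        gcongr
        exact Real.dist_le_of_mem_Icc_01 (hK.subset_Icc hM.invariant hzK)
          (hK.subset_Icc hM.invariant hy)
      have h3 : nndist (S.wordMap w y) x₀ ≤ r := by
        have := (Metric.edist_le_ediam_of_mem hyU hx₀U).trans hU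
        rw [edist_nndist] at this
        exact_mod_cast this
      have h4 : dist (S.wordMap w y) x₀ ≤ r := h3
      linarith [dist_triangle (S.wordMap w z) (S.wordMap w y) x₀]
    have h5 : |(S.wordMap w z - x₀) / (c * d * r)| ≤ 2 / (c * d) := by
      rw [abs_div, abs_of_pos hcdr, ← Real.dist_eq, div_le_div_iff₀ hcdr (by positivity)]
      calc _ ≤ 2 * r * (c * d) := by gcongr
        _ = _ := by ring
    obtain ⟨h6, h7⟩ := abs_le.1 h5
    have h8 := Int.le_ceil (2 / ((c : ℝ) * d))
    rw [Finset.mem_Icc]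
    constructor
    · rw [hcell, Int.le_floor, hQ]; push_cast; linarith
    · have : cell w < Q + 1 := by
        rw [hcell, Int.floor_lt, hQ]; push_cast; linarith
      omega
  have hmeet : ∀ v ∈ A, ∀ w ∈ A, cell v = cell w → (S.wordPerm v)⁻¹ * S.wordPerm w ∈ hΔ.toFinset := by
    intro v hv w hw hvw
    rw [Set.Finite.mem_toFinset]
    have key : ∀ v ∈ A, ∀ w ∈ A, S.ratio v ≤ c⁻¹ * S.ratio w := fun v hv w hw => by
      rw [le_inv_mul_iff₀ hc0]
      exact (mul_le_mul_right hv.1 c).trans hw.2.1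
    refine ⟨v, w, key v hv w hw, key w hw v hv, ⟨S.wordMap w z, ?_, mem_image_of_mem _ hzK⟩, rfl⟩
    refine (S.ball_subset_wordMap_image v z d).trans (image_mono hd) ?_
    have := Int.abs_sub_lt_one_of_floor_eq_floor hvw
    rw [← sub_div, abs_div, abs_of_pos hcdr, div_lt_one hcdr, sub_sub_sub_cancel_right, abs_sub_comm,
      ← Real.dist_eq] at this
    rw [Metric.mem_ball]
    have h1 : (c * r : ℝ) ≤ S.ratio v := by exact_mod_cast hv.2.1
    calc _ < c * d * r := this
      _ = c * r * d := by ring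
      _ ≤ _ := by gcongr
  have hrep : ∀ q : ℤ, ∃ v : Word m, ∀ w ∈ A, cell w = q → v ∈ A ∧ cell v = q := fun q => by
    by_cases h : ∃ v ∈ A, cell v = q
    · exact ⟨h.choose, fun _ _ _ => h.choose_spec⟩
    · exact ⟨[], fun w hw hq => absurd ⟨w, hw, hq⟩ h⟩
  choose rep hrep using hrep
  -- The reference word depends only on the cell, so the label determines the map `S_w`. One word
  -- per label therefore gives all the copies required.
  set label : Word m → ℤ × Equiv.Perm ℝ :=
    fun w => (cell w, (S.wordPerm (rep (cell w)))⁻¹ * S.wordPerm w) with hlabel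
  have hlabelA : label '' A ⊆ (Finset.Icc (-Q) Q ×ˢ hΔ.toFinset : Finset (ℤ × Equiv.Perm ℝ)) := by
    rintro _ ⟨w, hw, rfl⟩
    have h := hrep _ w hw rfl
    exact Finset.mem_coe.2 (Finset.mk_mem_product (hcellQ w hw) (hmeet _ h.1 w hw h.2))
  obtain ⟨A', hA', hbij⟩ := Set.exists_subset_bijOn A label
  have hA'fin : A'.Finite := by
    rw [hbij.finite_iff_finite]
    exact (Finset.finite_toSet _).subset hlabelA
  refine ⟨hA'fin.toFinset, ?_, fun w hw => (hA' (hA'fin.mem_toFinset.1 hw)).1, ?_⟩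
  · refine Finset.card_le_card_of_injOn label (fun w hw => ?_) ?_
    · exact hlabelA (hbij.mapsTo (by simpa using hw))
    · simpa using hbij.injOn
  · rintro x ⟨hxK, hxU⟩
    obtain ⟨w, hwr, hcw, hxw⟩ := hK.exists_word_ratio_mem hc hr0 hr1 hxK
    obtain ⟨v, hv, hvw⟩ := hbij.surjOn (mem_image_of_mem label (show w ∈ A from ⟨hwr, hcw, x, hxw, hxU⟩))
    have hvw2 : S.wordPerm v = S.wordPerm w := by
      have h1 : cell v = cell w := congrArg Prod.fst hvw
      have h2 := congrArg Prod.snd hvw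
      simp only [hlabel, h1] at h2
      exact mul_left_cancel h2
    refine mem_iUnion₂.2 ⟨v, by simpa using hv, ?_⟩
    rwa [← S.coe_wordPerm, hvw2, S.coe_wordPerm]

end LinearIFS

end LinearCantor

namespace LinearCantor

open Topology

namespace LinearIFS

variable {m : ℕ} {S : LinearIFS m} {M : ℕ → Finset (Word m)}

namespace IsAttractor

variable {K : Set ℝ} (hK : S.IsAttractor K)
include hK

/-! ### Positivity of the Hausdorff measure -/

/-- If `K` is covered by finitely many of its copies of total `β`-weight less than one, then
`H^β(K) = 0`. -/
theorem hausdorffMeasure_eq_zero_of_sum_lt_one {β : ℝ} (hβ : 0 < β) {F : Finset (Word m)}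
    (hcov : K ⊆ ⋃ w ∈ F, S.wordMap w '' K) (hF : ∑ w ∈ F, (S.ratio w : ℝ≥0∞) ^ β < 1) :
    μH[β] K = 0 := by
  classical
  set q := ∑ w ∈ F, (S.ratio w : ℝ≥0∞) ^ β with hq
  have key : ∀ n : ℕ, ∃ G : Finset (Word m), K ⊆ ⋃ w ∈ G, S.wordMap w '' K ∧
      ∑ w ∈ G, (S.ratio w : ℝ≥0∞) ^ β ≤ q ^ n := by
    intro n
    induction n with
    | zero => exact ⟨{[]}, by simp [wordMap], by simp⟩
    | succ n ih =>
      obtain ⟨G, hG, hGq⟩ := ih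
      -- Substituting the cover into itself multiplies the weights; coinciding concatenations only
      -- lower the sum.
      refine ⟨(G ×ˢ F).image fun p => p.1 ++ p.2, fun x hx => ?_, ?_⟩
      · obtain ⟨v, hv, y, hy, rfl⟩ := mem_iUnion₂.1 (hG hx)
        obtain ⟨w, hw, z, hz, rfl⟩ := mem_iUnion₂.1 (hcov hy)
        refine mem_iUnion₂.2 ⟨v ++ w, Finset.mem_image.2 ⟨(v, w), Finset.mk_mem_product hv hw, rfl⟩,
          z, hz, ?_⟩
        rw [S.wordMap_append]; rfl
      · calc _ ≤ ∑ p ∈ G ×ˢ F, (S.ratio (p.1 ++ p.2) : ℝ≥0∞) ^ β :=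
              Finset.sum_image_le_of_nonneg fun _ _ => zero_le
          _ = (∑ w ∈ G, (S.ratio w : ℝ≥0∞) ^ β) * q := by
              rw [hq, Finset.sum_mul_sum, Finset.sum_product]
              simp_rw [ratio_append, ENNReal.coe_mul, ENNReal.mul_rpow_of_nonneg _ _ hβ.le]
          _ ≤ q ^ (n + 1) := by rw [pow_succ]; exact mul_le_mul_left hGq _
  choose G hG hGq using key
  have hD : Metric.ediam K ≠ ∞ := hK.isCompact.isBounded.ediam_ne_top
  have hqlim : Tendsto (fun n : ℕ => q ^ n) atTop (𝓝 0) :=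
    ENNReal.tendsto_pow_atTop_nhds_zero_of_lt_one hF
  have hlim1 : Tendsto (fun n : ℕ => (q ^ n) ^ β⁻¹ * Metric.ediam K) atTop (𝓝 0) := by
    have := ENNReal.Tendsto.mul_const (b := Metric.ediam K)
      ((ENNReal.continuous_rpow_const (y := β⁻¹)).continuousAt.tendsto.comp hqlim) (Or.inr hD)
    simpa [Function.comp_def, hβ] using this
  have hlim2 : Tendsto (fun n : ℕ => q ^ n * Metric.ediam K ^ β) atTop (𝓝 0) := by
    simpa using ENNReal.Tendsto.mul_const hqlim
      (Or.inr (ENNReal.rpow_ne_top_of_nonneg hβ.le hD))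
  refine nonpos_iff_eq_zero.1 ((Measure.hausdorffMeasure_le_liminf_tsum β K (l := atTop) _ hlim1
    (ι := fun n => G n) (fun n w => S.wordMap w '' K)
    (Eventually.of_forall fun n w => ?_) (Eventually.of_forall fun n => ?_)).trans ?_)
  · refine (S.ediam_wordMap_image_le _ _).trans (mul_le_mul_left ?_ _)
    rw [ENNReal.le_rpow_inv_iff hβ]
    exact (Finset.single_le_sum (f := fun w => (S.ratio w : ℝ≥0∞) ^ β)
      (fun _ _ => zero_le) w.2).trans (hGq n)
  · intro x hx
    obtain ⟨w, hw, h⟩ := mem_iUnion₂.1 (hG n hx)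
    exact mem_iUnion.2 ⟨⟨w, hw⟩, h⟩
  · rw [← hlim2.liminf_eq]
    refine liminf_le_liminf (Eventually.of_forall fun n => ?_)
    calc _ ≤ ∑' w : G n, (S.ratio w : ℝ≥0∞) ^ β * Metric.ediam K ^ β := by
          refine ENNReal.tsum_le_tsum fun w => ?_
          rw [← ENNReal.mul_rpow_of_nonneg _ _ hβ.le]
          exact ENNReal.rpow_le_rpow (S.ediam_wordMap_image_le _ _) hβ.le
      _ = (∑ w ∈ G n, (S.ratio w : ℝ≥0∞) ^ β) * Metric.ediam K ^ β := by
          rw [ENNReal.tsum_mul_right, Finset.tsum_subtype (G n)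
            (fun w => (S.ratio w : ℝ≥0∞) ^ β)]
      _ ≤ _ := mul_le_mul_left (hGq n) _

/-- Under the generalized finite type condition the attractor has positive Hausdorff measure in its
dimension. -/
theorem hausdorffMeasure_pos (hM : S.IsGeneralizedFiniteType M) {α : ℝ≥0} (hα : dimH K = α)
    (hα0 : 0 < α) : 0 < μH[(α : ℝ)] K := by
  classical
  rw [pos_iff_ne_zero]
  intro h0
  have hα' : (0 : ℝ) < α := hα0
  -- Otherwise K is contained in `{0, 1}` and has dimension zero.
  obtain ⟨z, hzK, hz⟩ : ∃ z ∈ K, z ∈ Ioo 0 1 := by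
    by_contra! h
    have hfin : K.Finite := (Set.toFinite {0, 1}).subset fun x hx => by
      have h1 := hK.subset_Icc hM.invariant hx
      by_contra h2
      simp only [mem_insert_iff, mem_singleton_iff, not_or] at h2
      exact h x hx ⟨h1.1.lt_of_ne' h2.1, h1.2.lt_of_ne h2.2⟩
    rw [hfin.dimH_zero] at hα
    exact hα0.ne (by exact_mod_cast hα)
  obtain ⟨N, hN⟩ := hK.exists_card_le_cover hM hzK hz
  -- Replacing each set by at most N copies multiplies the weight by at most N, so `1/(N+1)`
  -- suffices; it also forces every radius below 1.
  obtain ⟨T, U, r, hT, hr0, hUr, hsum⟩ := exists_finite_cover_of_hausdorffMeasure_eq_zero hα'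
    hK.isCompact h0 (ε := ((N : ℝ≥0∞) + 1)⁻¹) (by simp)
  have hr1 : ∀ n ∈ T, r n < 1 := fun n hn => by
    have h1 : (r n : ℝ≥0∞) ^ (α : ℝ) < 1 := calc
      _ ≤ _ := Finset.single_le_sum (f := fun n => (r n : ℝ≥0∞) ^ (α : ℝ)) (fun _ _ => zero_le) hn
      _ < ((N : ℝ≥0∞) + 1)⁻¹ := hsum
      _ ≤ 1 := by simp
    by_contra! h2
    exact h1.not_ge (ENNReal.one_le_rpow (by exact_mod_cast h2) hα')
  have : ∀ n, ∃ F : Finset (Word m), n ∈ T → F.card ≤ N ∧ (∀ w ∈ F, S.ratio w ≤ r n) ∧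
      K ∩ U n ⊆ ⋃ w ∈ F, S.wordMap w '' K := fun n => by
    by_cases hn : n ∈ T
    · obtain ⟨F, hF⟩ := hN (r n) (hr0 n) (hr1 n hn) (U n) (hUr n)
      exact ⟨F, fun _ => hF⟩
    · exact ⟨∅, fun h => absurd h hn⟩
  choose F hF using this
  have hcov : K ⊆ ⋃ w ∈ T.biUnion F, S.wordMap w '' K := by
    intro x hx
    obtain ⟨n, hn, hxn⟩ := mem_iUnion₂.1 (hT hx)
    obtain ⟨w, hw, hxw⟩ := mem_iUnion₂.1 ((hF n hn).2.2 ⟨hx, hxn⟩)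
    exact mem_iUnion₂.2 ⟨w, Finset.mem_biUnion.2 ⟨n, hn, hw⟩, hxw⟩
  have hlt : ∑ w ∈ T.biUnion F, (S.ratio w : ℝ≥0∞) ^ (α : ℝ) < 1 := calc
    _ ≤ ∑ n ∈ T, ∑ w ∈ F n, (S.ratio w : ℝ≥0∞) ^ (α : ℝ) := by
      rw [show T.biUnion F = (T.sigma F).image Sigma.snd by ext; simp, Finset.sum_sigma']
      exact Finset.sum_image_le_of_nonneg fun _ _ => zero_le
    _ ≤ ∑ n ∈ T, N * (r n : ℝ≥0∞) ^ (α : ℝ) := by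
      refine Finset.sum_le_sum fun n hn => (Finset.sum_le_card_nsmul (F n) _
        ((r n : ℝ≥0∞) ^ (α : ℝ)) fun w hw => ENNReal.rpow_le_rpow
        (by exact_mod_cast (hF n hn).2.1 w hw) hα'.le).trans ?_
      rw [nsmul_eq_mul]
      gcongr
      exact (hF n hn).1
    _ = N * ∑ n ∈ T, (r n : ℝ≥0∞) ^ (α : ℝ) := (Finset.mul_sum _ _ _).symm
    _ ≤ (N + 1) * ∑ n ∈ T, (r n : ℝ≥0∞) ^ (α : ℝ) := by gcongr; simp
    _ < (N + 1) * ((N : ℝ≥0∞) + 1)⁻¹ :=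
      ENNReal.mul_lt_mul_right (by simp) (by finiteness) hsum
    _ = 1 := ENNReal.mul_inv_cancel (by simp) (by finiteness)
  -- The finite sum stays below 1 slightly to the left of α.
  obtain ⟨β, ⟨hβ1, hβα⟩, hβ0⟩ := ((((tendsto_sum_rpow (T.biUnion F) S.ratio
    (fun w _ => (S.ratio_word_pos w).ne') α).mono_left nhdsWithin_le_nhds).eventually_lt_const
    hlt).and (self_mem_nhdsWithin (s := Iio (α : ℝ)))).and
    (mem_nhdsWithin_of_mem_nhds (lt_mem_nhds hα')) |>.exists
  lift β to ℝ≥0 using hβ0.le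
  have h1 := hK.hausdorffMeasure_eq_zero_of_sum_lt_one hβ0 hcov hβ1
  have h2 := dimH_le_of_hausdorffMeasure_ne_top (d := β) (s := K) (by rw [h1]; simp)
  rw [hα, ENNReal.coe_le_coe] at h2
  exact (mem_Iio.1 hβα).not_ge (NNReal.coe_le_coe.2 h2)

/-! ### The Hausdorff measure of intervals -/

/-- K is a cover of itself, and covers need not be fine here. -/
theorem hausdorffMeasure_lt_top {α : ℝ≥0} (hα : dimH K = α) (hα0 : 0 < α) :
    μH[(α : ℝ)] K < ∞ := by
  have hα' : (0 : ℝ) < α := hα0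
  refine (hK.hausdorffMeasure_le_tsum hα hα0 (fun n => if n = 0 then K else ∅) fun x hx =>
    mem_iUnion.2 ⟨0, by simpa using hx⟩).trans_lt ?_
  rw [tsum_eq_single 0 fun n hn => by simp [hn, hα0]]
  exact ENNReal.rpow_lt_top_of_nonneg hα'.le (by
    simpa using hK.isCompact.isBounded.ediam_ne_top)

/-- The Hausdorff measure of the part of `K` in a measurable set `J` is at most `|J| ^ α`. -/
theorem hausdorffMeasure_inter_le {α : ℝ≥0} (hα : dimH K = α) (hα0 : 0 < α) {J : Set ℝ}
    (hJ : MeasurableSet J) : μH[(α : ℝ)] (K ∩ J) ≤ Metric.ediam J ^ (α : ℝ) := by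
  have hα' : (0 : ℝ) < α := hα0
  have hfin := hK.hausdorffMeasure_lt_top hα hα0
  have hdiff : μH[(α : ℝ)] (K \ J) ≠ ∞ := ((measure_mono sdiff_subset).trans_lt hfin).ne
  have h1 : μH[(α : ℝ)] K ≤ Metric.ediam J ^ (α : ℝ) + μH[(α : ℝ)] (K \ J) := by
    refine ENNReal.le_of_forall_pos_le_add fun ε hε _ => ?_
    obtain ⟨U, hU, -, hs⟩ := exists_cover_of_hausdorffMeasure_lt hα' (A := K \ J)
      (ENNReal.lt_add_right hdiff (ENNReal.coe_pos.2 hε).ne')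
    -- J is put in front of a near-optimal cover of `K \ J`. Its size is immaterial in
    -- `hausdorffMeasure_le_tsum`, and the finite measure of `K \ J` cancels at the end.
    let V : ℕ → Set ℝ := fun n => if n = 0 then J else U (n - 1)
    refine (hK.hausdorffMeasure_le_tsum hα hα0 V ?_).trans ?_
    · intro x hx
      by_cases hxJ : x ∈ J
      · exact mem_iUnion.2 ⟨0, by simpa [V] using hxJ⟩
      · obtain ⟨n, hn⟩ := mem_iUnion.1 (hU ⟨hx, hxJ⟩)
        exact mem_iUnion.2 ⟨n + 1, by simpa [V] using hn⟩
    · have hsplit : ∑' n, Metric.ediam (V n) ^ (α : ℝ) =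
          Metric.ediam J ^ (α : ℝ) + ∑' n, Metric.ediam (U n) ^ (α : ℝ) :=
        tsum_eq_zero_add' (f := fun n => Metric.ediam (V n) ^ (α : ℝ)) ENNReal.summable
      rw [hsplit, add_assoc]
      exact add_le_add le_rfl hs.le
  rw [← measure_inter_add_sdiff K hJ] at h1
  exact (ENNReal.add_le_add_iff_right hdiff).1 h1

/-- A constant bounding `λ(J) / |J| ^ α` for all nondegenerate intervals `J ⊆ [0,1]`, `λ` being the
normalized Hausdorff measure on `K`, is at least `H^α(K)⁻¹`. -/
theorem inv_le_of_forall_interval {α : ℝ≥0} (hS : S.UnitIntervalInvariant) (hα0 : 0 < α)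
    (h0 : μH[(α : ℝ)] K ≠ 0) (hfin : μH[(α : ℝ)] K ≠ ∞) {D : ℝ≥0∞}
    (hD : ∀ J : Set ℝ, J.OrdConnected → J ⊆ Icc 0 1 → 0 < Metric.ediam J →
      (μH[(α : ℝ)] K)⁻¹ * μH[(α : ℝ)] (J ∩ K) ≤ D * Metric.ediam J ^ (α : ℝ)) :
    (μH[(α : ℝ)] K)⁻¹ ≤ D := by
  have hα' : (0 : ℝ) < α := hα0
  by_contra! h
  rw [ENNReal.lt_inv_iff_lt_inv] at h
  obtain ⟨U, hU, -, hs⟩ := exists_cover_of_hausdorffMeasure_lt hα' h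
  have hone : ∀ n, (μH[(α : ℝ)] K)⁻¹ * μH[(α : ℝ)] (convexHull ℝ (U n ∩ K) ∩ K) ≤
      D * Metric.ediam (U n) ^ (α : ℝ) := by
    intro n
    -- The hull is an interval in [0,1] of diameter no larger than that of `U n`. A degenerate hull
    -- falls outside the hypothesis on D but is null because α > 0.
    set J := convexHull ℝ (U n ∩ K) with hJ
    have hJd : Metric.ediam J ≤ Metric.ediam (U n) := by
      rw [hJ, convexHull_ediam]; exact Metric.ediam_mono inter_subset_left
    rcases (zero_le (a := Metric.ediam J)).eq_or_lt with h | h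
    · have hsub : J.Subsingleton := Metric.ediam_eq_zero_iff.1 h.symm
      have := Measure.nullSingletonClass_hausdorff ℝ hα'
      rw [(hsub.anti inter_subset_left).measure_zero]
      simp
    · refine (hD J (convex_convexHull ℝ _).ordConnected (convexHull_min ?_ (convex_Icc 0 1)) h).trans ?_
      · exact inter_subset_right.trans (hK.subset_Icc hS)
      · gcongr
  have h1 : 1 ≤ D * ∑' n, Metric.ediam (U n) ^ (α : ℝ) := calc
    1 = (μH[(α : ℝ)] K)⁻¹ * μH[(α : ℝ)] K := (ENNReal.inv_mul_cancel h0 hfin).symm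
    _ ≤ (μH[(α : ℝ)] K)⁻¹ * ∑' n, μH[(α : ℝ)] (convexHull ℝ (U n ∩ K) ∩ K) := by
      gcongr
      refine (measure_mono fun x hx => ?_).trans (measure_iUnion_le _)
      obtain ⟨n, hn⟩ := mem_iUnion.1 (hU hx)
      exact mem_iUnion.2 ⟨n, subset_convexHull ℝ _ ⟨hn, hx⟩, hx⟩
    _ ≤ ∑' n, D * Metric.ediam (U n) ^ (α : ℝ) := by
      rw [← ENNReal.tsum_mul_left]
      exact ENNReal.tsum_le_tsum hone
    _ = _ := ENNReal.tsum_mul_left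
  rcases eq_or_ne D 0 with rfl | hD0
  · simp at h1
  · have hDt : D ≠ ∞ := by rintro rfl; simp at h
    have := (ENNReal.mul_lt_mul_right hD0 hDt hs).trans_le (ENNReal.mul_inv_le_one D)
    exact this.not_ge h1

end IsAttractor

end LinearIFS

/-! ### The density formula -/

theorem normalizedHausdorff_apply {α : ℝ} {K J : Set ℝ} (hJ : MeasurableSet J) :
    normalizedHausdorff α K J = (μH[α] K)⁻¹ * μH[α] (J ∩ K) := by
  rw [normalizedHausdorff, Measure.smul_apply, Measure.restrict_apply hJ, smul_eq_mul]

end LinearCantor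

theorem corollary1p3 {m : ℕ} (S : LinearCantor.LinearIFS m)
    (M : ℕ → Finset (LinearCantor.Word m)) (hM : S.IsGeneralizedFiniteType M)
    (K : Set ℝ) (hK : S.IsAttractor K)
    (α : ℝ≥0) (hα : dimH K = α)
    (rep : S.OverlapType M → S.Island M) (hrep : ∀ T, (rep T).overlapType = T)
    (hirr : (LinearCantor.LinearIFS.weightedIncidence rep (α : ℝ)).IsIrreducible) :
    0 < μH[(α : ℝ)] K ∧ μH[(α : ℝ)] K < ∞ ∧
      (μH[(α : ℝ)] K)⁻¹ =
        sSup {d : ℝ≥0∞ | ∃ J : Set ℝ, J.OrdConnected ∧ J ⊆ Icc 0 1 ∧ 0 < Metric.ediam J ∧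
          d = LinearCantor.normalizedHausdorff (α : ℝ) K J / Metric.ediam J ^ (α : ℝ)} := by
  have hbdd : ∀ J : Set ℝ, J ⊆ Icc 0 1 → Metric.ediam J ≠ ∞ := fun J hJ =>
    ((Metric.isBounded_Icc 0 1).subset hJ).ediam_ne_top
  rcases eq_or_ne α 0 with rfl | hα0
  · obtain ⟨x, rfl⟩ := (hK.subsingleton_of_dimH_eq_zero (by simpa using hα)
      ).eq_empty_or_singleton.resolve_left hK.nonempty.ne_empty
    have hx : x ∈ Icc 0 1 := hK.subset_Icc hM.invariant rfl
    have h1 : μH[((0 : ℝ≥0) : ℝ)] {x} = 1 := by simp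
    rw [h1]
    -- For a point mass and exponent zero every quotient is `λ(J) ≤ 1`, and `J = [0,1]` attains 1.
    refine ⟨one_pos, ENNReal.one_lt_top, le_antisymm (le_sSup ⟨Icc 0 1, ordConnected_Icc, le_rfl,
      by simp, ?_⟩) (sSup_le ?_)⟩
    · rw [LinearCantor.normalizedHausdorff_apply measurableSet_Icc,
        inter_eq_right.2 (singleton_subset_iff.2 hx), h1]
      simp
    · rintro _ ⟨J, hJ, -, -, rfl⟩
      rw [LinearCantor.normalizedHausdorff_apply hJ.measurableSet, h1]
      have := measure_mono (μ := μH[((0 : ℝ≥0) : ℝ)]) (inter_subset_right (s := J) (t := {x}))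
      rw [h1] at this
      simpa using this
  · have hα0' : 0 < α := pos_iff_ne_zero.2 hα0
    have hα' : (0 : ℝ) < α := hα0'
    have hpos := hK.hausdorffMeasure_pos hM hα hα0'
    have hfin := hK.hausdorffMeasure_lt_top hα hα0'
    refine ⟨hpos, hfin, le_antisymm ?_ (sSup_le ?_)⟩
    · refine hK.inv_le_of_forall_interval hM.invariant hα0' hpos.ne' hfin.ne fun J hJ hJ1 hJ0 => ?_
      rw [← ENNReal.div_le_iff (by simp [hJ0.ne'])
        (ENNReal.rpow_ne_top_of_nonneg hα'.le (hbdd J hJ1)),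
        ← LinearCantor.normalizedHausdorff_apply hJ.measurableSet]
      exact le_sSup ⟨J, hJ, hJ1, hJ0, rfl⟩
    · rintro _ ⟨J, hJ, -, -, rfl⟩
      rw [LinearCantor.normalizedHausdorff_apply hJ.measurableSet, inter_comm]
      exact ENNReal.div_le_of_le_mul
        (mul_le_mul_right (hK.hausdorffMeasure_inter_le hα hα0' hJ.measurableSet) _)
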